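/- Throughout, $G$ is a finite group belonging to the class $\mathcal C$, that is, every subgroup of $G$ and every quotient group of $G$ is either abelian or contains a non-central abelian normal subgroup. Let $N$ be a normal subgroup of $G$. **Notation.** Conjugates are $a^x=x^{-1}ax$. For a character $\psi$ of a subgroup $X$ of $G$ and $x\in G$, $\psi^x(g)=\psi(xgx^{-1})$ for $g \in x^{-1}Xx$, and $\psi^L$ is the character induced to a subgroup $L\ge X$. For a subgroup $X\le G$ and $a\in\mathbb QG$ put $\operatorname{Cen}_X(a)=\{x\in X: xa=ax\}$, and let $N_X(B)$ be the normalizer of $B$ in $X$. For $K\unlhd H\le G$ put $\widehat H=\frac1{|H|}\sum_{h\in H}h$; $\varepsilon(H,K)=\widehat K$ if $H=K$, and $\varepsilon(H,K)=\prod_L(\widehat K-\widehat L)$ otherwise, where $L$ runs over the minimal ones among the normal subgroups of $H$ containing $K$ properly; and for $X\le G$ let $e(X,H,K)\in\mathbb QG$ be the sum of all the distinct $X$-conjugates of $\varepsilon(H,K)$. The pair $(H,K)$ is a Shoda pair of $G$ if $K\unlhd H$, $H/K$ is cyclic, and every $g\in G$ with $\{[h,g]:h\in H\}\cap H\subseteq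 K$ lies in $H$. In that case $\alpha_{(G,H,K)}$ denotes the unique rational number such that $\alpha_{(G,H,K)}\,e(G,H,K)$ is a primitive central idempotent of $\mathbb QG$. **The tree.** An $N$-linear character triple $(H,A,\vartheta)$ of $G$ consists of subgroups $A\unlhd H\le G$ and a linear character $\vartheta$ of $A$ that is invariant in $H$ and satisfies $\ker\vartheta^G=N$. For each such triple fix a normal subgroup $\mathcal A=\mathcal A_{(H,A,\vartheta)}$ of $H$ of maximal order among those that contain $\ker\vartheta$ and are abelian modulo $\ker\vartheta$. Let $\widetilde{\operatorname{Lin}}(\mathcal A|\vartheta)$ be the set of linear characters $\varphi$ of $\mathcal A$ with $\varphi|_A=\vartheta$ and $\ker\varphi^G=N$, and fix a set $\mathfrak{Lin}(\mathcal A|\vartheta)$ of representatives of its orbits under $\varphi\mapsto\sigma\circ\varphi^h$, where $h\in H$ and $\sigma$ is an automorphism of $\mathbb C$ fixing $\mathbb Q(\vartheta)$ elementwise. If $H\ne A$, the direct Clifford correspondents of $(H,A,\vartheta)$ are the triples $(I_H(\varphi),\mathcal A,\varphi)$ with $\varphi\in\mathfrak{Lin}(\mathcal A|\vartheta)$, where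 $I_H(\varphi)=\{h\in H:\varphi^h=\varphi\}$; if $H=A$ there are none. Consider the directed graph on the $N$-linear character triples of $G$ with an edge from $u$ to $v$ whenever $v$ is a direct Clifford correspondent of $u$. Let $\mathcal L_N$ be the set of the sinks of the form $(H,H,\vartheta)$ that are reachable by a directed path (without repeated vertices) from $(G,N,1_N)$. If $v_1,\dots,v_n$ is the directed path from $v_1=(G,N,1_N)$ to $v_n=(H,H,\vartheta)\in\mathcal L_N$, then $n$ is the height and $v_i=(H_i,A_i,\vartheta_i)$ is the $i$-th node of $(H,H,\vartheta)$. The leaf $(H,H,\vartheta)$ is good if for all $1<i\le n$ and all $x\in N_{H_{i-1}}(\ker\vartheta_i)$ there is an automorphism $\sigma$ of $\mathbb C$ with $(\vartheta^{H_i})^x=\sigma\circ\vartheta^{H_i}$. **Theorem 5.1.** Let $(H,H,\vartheta)\in\mathcal L_N$ be of height $n$ with $i$-th node $(H_i,A_i,\vartheta_i)$, $1\le i\le n$, and let $K=\ker\vartheta$. Then $(H,K)$ is a Shoda pair of $G$, and the following hold. (i) If $n\ge2$, then $$\alpha_{(G,H,K)}=\frac{[\operatorname{Cen}_G(\varepsilon(H,K)):\operatorname{Cen}_{H_{n-1}}(\varepsilon(H,K))]}{\prod_{2\le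 i\le n-1}[\operatorname{Cen}_{H_{i-1}}(e(H_i,H,K)):H_i]}.$$ (ii) $\alpha_{(G,H,K)}=1$ if and only if $\operatorname{Cen}_{H_{i-1}}(e(H_i,H,K))=\operatorname{Cen}_{H_{i-1}}(\varepsilon(H,K))H_i$ for all $2\le i\le n-1$. (In particular $\alpha_{(G,H,K)}=1$ if $n\le2$.) (iii) If $(H,H,\vartheta)$ is good, then $\operatorname{Cen}_{H_{i-1}}(e(H_i,H,K))=N_{H_{i-1}}(\ker\vartheta_i)$ for all $2\le i\le n-1$, so that $\operatorname{Cen}_{H_{i-1}}(e(H_i,H,K))$ can be replaced by $N_{H_{i-1}}(\ker\vartheta_i)$ in (i) and (ii). -/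

import Mathlib

open scoped Pointwise

noncomputable section

namespace CliffordTree

/-! ## The class of groups -/

/-- `X` is abelian or contains a non-central abelian normal subgroup. -/
def AbelianOrNoncentral (X : Type*) [Group X] : Prop :=
  (∀ a b : X, a * b = b * a) ∨
    ∃ B : Subgroup X, B.Normal ∧ (∀ a ∈ B, ∀ b ∈ B, a * b = b * a) ∧ ¬ B ≤ Subgroup.center X

/-- The class `𝒞`: every subgroup and every quotient group of `G` is abelian or contains a
non-central abelian normal subgroup. (Finiteness of `G` is assumed separately.) -/
def InClassC (G : Type*) [Group G] : Prop :=
  (∀ X : Subgroup G, AbelianOrNoncentral X) ∧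
    ∀ (M : Subgroup G) [M.Normal], AbelianOrNoncentral (G ⧸ M)

/-! ## Elements of the rational group algebra -/

/-- The elements of a subgroup of a finite group, as a finset. -/
def elems {G : Type*} [Group G] [Finite G] (H : Subgroup G) : Finset G :=
  (Set.toFinite (H : Set G)).toFinset

/-- The conjugate `a ^ x = x⁻¹ a x`, for `x : G` and `a` in the rational group algebra. -/
def conj {G : Type*} [Group G] (a : MonoidAlgebra ℚ G) (x : G) : MonoidAlgebra ℚ G :=
  MonoidAlgebra.of ℚ G x⁻¹ * a * MonoidAlgebra.of ℚ G x

/-- `Cen_X(a) = {x ∈ X | x a = a x}`, for a subgroup `X` of `G` and `a` in the rational group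
algebra of `G`. -/
def cen {G : Type*} [Group G] (X : Subgroup G) (a : MonoidAlgebra ℚ G) : Subgroup G where
  carrier := {x | x ∈ X ∧ MonoidAlgebra.of ℚ G x * a = a * MonoidAlgebra.of ℚ G x}
  one_mem' := ⟨X.one_mem, by simp only [map_one, one_mul, mul_one]⟩
  mul_mem' := by
    rintro x y ⟨hx, hxa⟩ ⟨hy, hya⟩
    refine ⟨X.mul_mem hx hy, ?_⟩
    rw [map_mul, mul_assoc, hya, ← mul_assoc, hxa, mul_assoc]
  inv_mem' := by
    rintro x ⟨hx, hxa⟩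
    refine ⟨X.inv_mem hx, ?_⟩
    have h1 : MonoidAlgebra.of ℚ G x⁻¹ * MonoidAlgebra.of ℚ G x = 1 := by
      rw [← map_mul, inv_mul_cancel, map_one]
    have h2 : MonoidAlgebra.of ℚ G x * MonoidAlgebra.of ℚ G x⁻¹ = 1 := by
      rw [← map_mul, mul_inv_cancel, map_one]
    calc MonoidAlgebra.of ℚ G x⁻¹ * a
        = MonoidAlgebra.of ℚ G x⁻¹ * (a * MonoidAlgebra.of ℚ G x) * MonoidAlgebra.of ℚ G x⁻¹ := by
          rw [mul_assoc, mul_assoc, h2, mul_one]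
      _ = a * MonoidAlgebra.of ℚ G x⁻¹ := by rw [← hxa, ← mul_assoc, h1, one_mul]

/-- `Ĥ = (1 / |H|) ∑_{h ∈ H} h`. -/
def hat {G : Type*} [Group G] [Finite G] (H : Subgroup G) : MonoidAlgebra ℚ G :=
  (Nat.card H : ℚ)⁻¹ • ∑ h ∈ elems H, MonoidAlgebra.of ℚ G h

/-- The minimal members among the normal subgroups of `H` that contain `K` properly. -/
def minOver {G : Type*} [Group G] (H K : Subgroup G) : Set (Subgroup G) :=
  {L | Minimal (fun M : Subgroup G =>
    M ≤ H ∧ H ≤ Subgroup.normalizer (M : Set G) ∧ K < M) L}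

theorem mem_elems {G : Type*} [Group G] [Finite G] {H : Subgroup G} {x : G} :
    x ∈ elems H ↔ x ∈ H := by
  simp [elems]

theorem of_commute_hat {G : Type*} [Group G] [Finite G] {M : Subgroup G} {x : G}
    (hx : x ∈ Subgroup.normalizer (M : Set G)) :
    Commute (MonoidAlgebra.of ℚ G x) (hat M) := by
  refine Commute.smul_right ?_ _
  unfold Commute SemiconjBy
  rw [Finset.mul_sum, Finset.sum_mul]
  refine Finset.sum_bij' (fun m _ => x * m * x⁻¹) (fun m _ => x⁻¹ * m * x) ?_ ?_ ?_ ?_ ?_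
  · intro m hm
    rw [mem_elems] at hm ⊢
    exact (Subgroup.mem_normalizer_iff.1 hx m).1 hm
  · intro m hm
    rw [mem_elems] at hm ⊢
    refine (Subgroup.mem_normalizer_iff.1 hx _).2 ?_
    simpa [mul_assoc] using hm
  · intro m _
    simp [mul_assoc]
  · intro m _
    simp [mul_assoc]
  · intro m _
    rw [← map_mul, ← map_mul]
    simp [mul_assoc]

theorem hat_commute_hat {G : Type*} [Group G] [Finite G] {L M : Subgroup G}
    (h : L ≤ Subgroup.normalizer (M : Set G)) : Commute (hat L) (hat M) := by
  refine Commute.smul_left ?_ _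
  exact Commute.sum_left _ _ _ fun x hx => of_commute_hat (h (mem_elems.1 hx))

theorem factors_commute {G : Type*} [Group G] [Finite G] (H K : Subgroup G) :
    (((Set.toFinite (minOver H K)).toFinset : Finset (Subgroup G)) :
      Set (Subgroup G)).Pairwise (Function.onFun Commute fun L => hat K - hat L) := by
  intro L hL M hM _
  simp only [Set.Finite.coe_toFinset] at hL hM
  have hKL : Commute (hat K) (hat L) :=
    hat_commute_hat ((hL.1.2.2.le.trans hL.1.1).trans hL.1.2.1)
  have hKM : Commute (hat K) (hat M) :=
    hat_commute_hat ((hM.1.2.2.le.trans hM.1.1).trans hM.1.2.1)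
  have hLM : Commute (hat L) (hat M) := hat_commute_hat (hL.1.1.trans hM.1.2.1)
  exact ((Commute.refl _).sub_right hKM).sub_left (hKL.symm.sub_right hLM)

open Classical in
/-- `ε(H, K)`: it is `K̂` if `H = K`, and otherwise the product of the (pairwise commuting)
elements `K̂ - L̂`, where `L` runs over the minimal normal subgroups of `H` containing `K`
properly. -/
def eps {G : Type*} [Group G] [Finite G] (H K : Subgroup G) : MonoidAlgebra ℚ G :=
  if H = K then hat K
  else (Set.toFinite (minOver H K)).toFinset.noncommProd (fun L => hat K - hat L)
    (factors_commute H K)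

/-- `e(X, H, K)`: the sum of all the distinct `X`-conjugates of `ε(H, K)`, for a subgroup `X`
of `G`. -/
def e {G : Type*} [Group G] [Finite G] (X H K : Subgroup G) : MonoidAlgebra ℚ G :=
  ∑ a ∈ (Set.finite_range fun x : X => conj (eps H K) (x : G)).toFinset, a

/-- `(H, K)` is a Shoda pair of `G`: `K` is normal in `H` with `H / K` cyclic, and every `g : G`
such that all commutators `[h, g] = h⁻¹ g⁻¹ h g`, `h ∈ H`, that lie in `H` lie in `K`, is itself
in `H`. -/
def IsShodaPair {G : Type*} [Group G] (H K : Subgroup G) : Prop :=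
  K ≤ H ∧ (∃ _ : (K.subgroupOf H).Normal, IsCyclic (H ⧸ K.subgroupOf H)) ∧
    ∀ g : G, (∀ h ∈ H, h⁻¹ * g⁻¹ * h * g ∈ H → h⁻¹ * g⁻¹ * h * g ∈ K) → g ∈ H

/-- `a` is a primitive central idempotent of the rational group algebra: a nonzero central
idempotent that is not the sum of two nonzero orthogonal central idempotents. -/
def IsPrimitiveCentralIdempotent {G : Type*} [Group G] (a : MonoidAlgebra ℚ G) : Prop :=
  a ≠ 0 ∧ IsIdempotentElem a ∧ a ∈ Set.center (MonoidAlgebra ℚ G) ∧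
    ∀ b c : MonoidAlgebra ℚ G, IsIdempotentElem b → IsIdempotentElem c →
      b ∈ Set.center (MonoidAlgebra ℚ G) → c ∈ Set.center (MonoidAlgebra ℚ G) →
      b * c = 0 → a = b + c → b = 0 ∨ c = 0

/-- At most one rational multiple of a given element is a primitive central idempotent. -/
theorem coeff_unique {G : Type*} [Group G] {a : MonoidAlgebra ℚ G} {r s : ℚ}
    (hr : IsPrimitiveCentralIdempotent (r • a)) (hs : IsPrimitiveCentralIdempotent (s • a)) :
    r = s := by
  have key : ∀ t : ℚ, IsPrimitiveCentralIdempotent (t • a) → t ≠ 0 ∧ t • (a * a) = a := by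
    intro t ht
    have h0 : t ≠ 0 := by
      rintro rfl
      exact ht.1 (zero_smul _ _)
    refine ⟨h0, ?_⟩
    have h1 : (t • a) * (t • a) = t • a := ht.2.1
    rw [smul_mul_smul_comm, mul_smul] at h1
    exact (smul_right_injective _ h0) h1
  obtain ⟨-, h1⟩ := key r hr
  obtain ⟨-, h2⟩ := key s hs
  have hne : a * a ≠ 0 := by
    intro h
    rw [h, smul_zero] at h1
    exact hr.1 (by rw [← h1, smul_zero])
  exact smul_left_injective ℚ hne (h1.trans h2.symm)

open Classical in
/-- `α_(G, H, K)`: the rational number `r`, unique if it exists (by `coeff_unique`), such that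
`r • e(G, H, K)` is a primitive central idempotent of the rational group algebra of `G`; the
value is `0` if there is none. -/
def alpha {G : Type*} [Group G] [Finite G] (H K : Subgroup G) : ℚ :=
  if h : ∃ r : ℚ, IsPrimitiveCentralIdempotent (r • e ⊤ H K) then h.choose else 0

/-! ## Linear characters and induced characters

Characters of subgroups of `G` are handled as functions on `G` that vanish outside the subgroup.
A linear character of `A` is a homomorphism `A →* ℂˣ`; its extension by zero is nonzero exactly
on `A`, so two such extensions agree iff the domains and the characters agree. -/

open Classical in
/-- The extension by zero to `G` of a linear character of the subgroup `A`. -/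
def ext {G : Type*} [Group G] {A : Subgroup G} (θ : A →* ℂˣ) : G → ℂ :=
  fun g => if h : g ∈ A then ((θ ⟨g, h⟩ : ℂˣ) : ℂ) else 0

/-- The kernel of a linear character of `A`, as a subgroup of `G`. -/
def kerIn {G : Type*} [Group G] {A : Subgroup G} (θ : A →* ℂˣ) : Subgroup G :=
  θ.ker.map A.subtype

/-- The character `θ ^ L` induced from `A` to a subgroup `L ≥ A`, extended by zero to `G`:
`θ ^ L (g) = (1 / |A|) ∑_{x ∈ L} θ(x g x⁻¹)`, where `θ` is read as zero outside `A`. -/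
def ind {G : Type*} [Group G] [Finite G] {A : Subgroup G} (L : Subgroup G) (θ : A →* ℂˣ) :
    G → ℂ :=
  fun g => (Nat.card A : ℂ)⁻¹ * ∑ x ∈ elems L, ext θ (x * g * x⁻¹)

/-- `ker θ ^ G = N`, where `ker χ = {g | χ(g) = χ(1)}`. -/
def IndKerEq {G : Type*} [Group G] [Finite G] {A : Subgroup G} (θ : A →* ℂˣ)
    (N : Subgroup G) : Prop :=
  {g : G | ind ⊤ θ g = ind ⊤ θ 1} = (N : Set G)

/-- The data `(H, A, θ)` of subgroups `H`, `A` of `G` and a linear character `θ` of `A`. -/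
structure Triple (G : Type*) [Group G] where
  /-- the subgroup `H` -/
  H : Subgroup G
  /-- the subgroup `A` -/
  A : Subgroup G
  /-- the linear character -/
  θ : A →* ℂˣ

/-- `(H, A, θ)` is an `N`-linear character triple of `G`: `A` is a normal subgroup of `H`, the
linear character `θ` of `A` is invariant in `H`, and `ker θ ^ G = N`. -/
def IsLinearTriple {G : Type*} [Group G] [Finite G] (N : Subgroup G) (v : Triple G) : Prop :=
  v.A ≤ v.H ∧ v.H ≤ Subgroup.normalizer (v.A : Set G) ∧
    (∀ h ∈ v.H, ∀ g : G, ext v.θ (h * g * h⁻¹) = ext v.θ g) ∧ IndKerEq v.θ N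

/-- `B` is a normal subgroup of `H` containing `ker θ` such that `B / ker θ` is abelian. -/
def IsAbelianOverKer {G : Type*} [Group G] (v : Triple G) (B : Subgroup G) : Prop :=
  kerIn v.θ ≤ B ∧ B ≤ v.H ∧ v.H ≤ Subgroup.normalizer (B : Set G) ∧
    ∀ x ∈ B, ∀ y ∈ B, x⁻¹ * y⁻¹ * x * y ∈ kerIn v.θ

/-- The set of linear characters `φ` of `B` that lie above `θ` (for linear characters: that
restrict to `θ` on `A`) and satisfy `ker φ ^ G = N`. -/
def linTilde {G : Type*} [Group G] [Finite G] (N : Subgroup G) (v : Triple G)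
    (B : Subgroup G) : Set (B →* ℂˣ) :=
  {φ | (∀ a ∈ v.A, ext φ a = ext v.θ a) ∧ IndKerEq φ N}

/-- `ψ = σ ∘ φ ^ h` for some `h ∈ H` and some automorphism `σ` of `ℂ` fixing `ℚ(θ)`
elementwise, where `φ ^ h (g) = φ(h g h⁻¹)`. -/
def SameOrbit {G : Type*} [Group G] (v : Triple G) {B : Subgroup G} (φ ψ : B →* ℂˣ) : Prop :=
  ∃ σ : ℂ ≃+* ℂ, (∀ z ∈ IntermediateField.adjoin ℚ (Set.range (ext v.θ)), σ z = z) ∧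
    ∃ h ∈ v.H, ∀ g : G, ext ψ g = σ (ext φ (h * g * h⁻¹))

/-- The choices on which the direct Clifford correspondents of the `N`-linear character triples
`v = (H, A, θ)` depend. -/
structure Choice {G : Type*} [Group G] [Finite G] (N : Subgroup G) where
  /-- a normal subgroup `𝒜` of `H` of maximal order among those that contain `ker θ` and are
  abelian modulo `ker θ` -/
  𝒜 : Triple G → Subgroup G
  /-- a set of representatives of the distinct orbits of `linTilde N v (𝒜 v)` -/
  rep : (v : Triple G) → Set (𝒜 v →* ℂˣ)
  isAbelianOverKer : ∀ v, IsLinearTriple N v → IsAbelianOverKer v (𝒜 v)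
  maximal : ∀ v, IsLinearTriple N v → ∀ B, IsAbelianOverKer v B → Nat.card B ≤ Nat.card (𝒜 v)
  rep_subset : ∀ v, IsLinearTriple N v → rep v ⊆ linTilde N v (𝒜 v)
  existsUnique_rep : ∀ v, IsLinearTriple N v → ∀ ψ ∈ linTilde N v (𝒜 v),
    ∃! φ, φ ∈ rep v ∧ SameOrbit v φ ψ

/-- The inertia group `I_H(φ) = {h ∈ H | φ ^ h = φ}`. -/
def inertia {G : Type*} [Group G] (H : Subgroup G) {B : Subgroup G} (φ : B →* ℂˣ) :
    Subgroup G where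
  carrier := {h | h ∈ H ∧ ∀ g : G, ext φ (h * g * h⁻¹) = ext φ g}
  one_mem' := ⟨H.one_mem, fun g => by simp⟩
  mul_mem' := by
    rintro x y ⟨hx, hx'⟩ ⟨hy, hy'⟩
    refine ⟨H.mul_mem hx hy, fun g => ?_⟩
    rw [← hy' g, ← hx' (y * g * y⁻¹)]
    simp only [mul_inv_rev, mul_assoc]
  inv_mem' := by
    rintro x ⟨hx, hx'⟩
    refine ⟨H.inv_mem hx, fun g => ?_⟩
    rw [← hx' (x⁻¹ * g * x⁻¹⁻¹)]
    simp [mul_assoc]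

/-- The set `Cl(H, A, θ)` of direct Clifford correspondents of `v = (H, A, θ)`. -/
def Cl {G : Type*} [Group G] [Finite G] {N : Subgroup G} (c : Choice N) (v : Triple G) :
    Set (Triple G) :=
  {w | v.H ≠ v.A ∧ ∃ φ ∈ c.rep v, w = ⟨inertia v.H φ, c.𝒜 v, φ⟩}

/-- The directed graph whose vertices are the `N`-linear character triples of `G`, with an edge
from `u` to `v` if `v` is a direct Clifford correspondent of `u`. -/
def Edge {G : Type*} [Group G] [Finite G] {N : Subgroup G} (c : Choice N) (u v : Triple G) :
    Prop :=
  IsLinearTriple N u ∧ IsLinearTriple N v ∧ v ∈ Cl c u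

/-- The triple `(G, N, 1_N)`. -/
def root {G : Type*} [Group G] (N : Subgroup G) : Triple G := ⟨⊤, N, 1⟩

/-- `v 1, …, v n` is a directed path (so without repeated vertices) from `(G, N, 1_N)` to `v n`.
The values `v i` for other `i` play no role. -/
def IsRootPath {G : Type*} [Group G] [Finite G] {N : Subgroup G} (c : Choice N)
    (v : ℕ → Triple G) (n : ℕ) : Prop :=
  1 ≤ n ∧ v 1 = root N ∧ (∀ i, 1 ≤ i → i < n → Edge c (v i) (v (i + 1))) ∧
    Set.InjOn v (Set.Icc 1 n)

/-- `(H, H, θ) ∈ ℒ_N` is a leaf of height `n`, and `v i` is its `i`-th node for `1 ≤ i ≤ n`: the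
directed path `v 1, …, v n` leads from the root to the vertex `(H, H, θ)`, which is a sink. -/
def IsLeaf {G : Type*} [Group G] [Finite G] {N : Subgroup G} (c : Choice N) (H : Subgroup G)
    (θ : H →* ℂˣ) (n : ℕ) (v : ℕ → Triple G) : Prop :=
  IsRootPath c v n ∧ v n = ⟨H, H, θ⟩ ∧ ∀ w, ¬ Edge c ⟨H, H, θ⟩ w

/-- `N_X(B)`, the normalizer of `B` in the subgroup `X`. -/
def normIn {G : Type*} [Group G] (X B : Subgroup G) : Subgroup G :=
  X ⊓ Subgroup.normalizer (B : Set G)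

/-- The leaf `(H, H, θ)` of height `n` with nodes `v i = (H_i, A_i, θ_i)` is good: for all
`1 < i ≤ n` and all `x` in the normalizer of `ker θ_i` in `H_{i-1}` there is an automorphism `σ`
of `ℂ` with `(θ ^ H_i) ^ x = σ ∘ θ ^ H_i`. -/
def IsGood {G : Type*} [Group G] [Finite G] {H : Subgroup G} (θ : H →* ℂˣ) (n : ℕ)
    (v : ℕ → Triple G) : Prop :=
  ∀ i, 1 < i → i ≤ n → ∀ x ∈ normIn (v (i - 1)).H (kerIn (v i).θ),
    ∃ σ : ℂ ≃+* ℂ, ∀ g ∈ (v i).H, ind (v i).H θ (x * g * x⁻¹) = σ (ind (v i).H θ g)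

end CliffordTree

end

open CliffordTree

noncomputable section

namespace CliffordTree

/-! Characters are replaced by idempotents of the rational group algebra. The `ℚ`-linear extension
of a linear character `θ` of `A` is a ring homomorphism from `ℚA` to `ℂ`. The element `ε(A, ker θ)`
is the central idempotent of `ℚA` on which it takes the value 1 and which its kernel annihilates
(`isCharIdem_eps`). As `ℂ` has no idempotents besides 0 and 1, conjugates of this idempotent under
the normalizer of `A` are equal or orthogonal.

The engine is an idempotent form of the Clifford correspondence
(`IsCliffordPair.isPrimCentral_orbSum`): if `L` is the inertia group of `θ` in `M` and `f` is a
primitive central idempotent of `ℚL` with `ε(A, ker θ) f = f`, then the distinct `M`-conjugates of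
`f` are orthogonal and their sum is a primitive central idempotent of `ℚM`. Climbing from `E = ε(H,
K)` at the leaf to the root yields such idempotents `f_i` of `ℚH_i` with `e(H_i, H, K) = μ_i f_i`
and `μ_i > 0` (`exists_isNodeIdem`). At the root, `α = 1 / μ_1`.

The rest is counting. Put `C = Cen_{H_{i-1}}(E)` and `T = Cen_{H_{i-1}}(e(H_i, H, K))`. Summing
conjugates in stages (`orbSum_tower`) gives `μ_{i-1} = μ_i |T| / |C H_i|`; equivalently,
`|Cen_{H_i}(E)| μ_i` is multiplied by `[T : H_i]` at each step up, which telescopes to (i). As `C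
H_i ⊆ T`, every ratio is at least 1, so the product is 1 only if every inclusion is an equality,
which is (ii).

For (iii), an element fixing `f_i` fixes `ε(A_i, ker θ_i)`, hence normalizes `ker θ_i`. Conversely,
if `x` normalizes `ker θ_i` but moves `f_i`, then the character induced from the leaf is nonzero at
`f_i` and zero at its conjugate, against goodness (`IsCliffordPair.normIn_le_cen`). The Shoda
condition comes from walking down the path: the commutator hypothesis puts `g` into one inertia
group after another (`path_mem_of_commutator`). -/

variable {G : Type*} [Group G]

/-! ## Subgroup algebras, conjugation and linear functionals -/

/-- The rational group algebra of the subgroup `X`, inside the rational group algebra of `G`. -/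
def subAlg (X : Subgroup G) : Subalgebra ℚ (MonoidAlgebra ℚ G) :=
  Algebra.adjoin ℚ (MonoidAlgebra.of ℚ G '' (X : Set G))

theorem of_mem_subAlg {X : Subgroup G} {x : G} (hx : x ∈ X) :
    MonoidAlgebra.of ℚ G x ∈ subAlg X :=
  Algebra.subset_adjoin ⟨x, hx, rfl⟩

theorem subAlg_mono {X Y : Subgroup G} (h : X ≤ Y) : subAlg X ≤ subAlg Y :=
  Algebra.adjoin_mono (Set.image_mono h)

theorem mem_subAlg_of_coeff {X : Subgroup G} {a : MonoidAlgebra ℚ G}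
    (h : ∀ x, x ∉ X → a.coeff x = 0) : a ∈ subAlg X := by
  rw [← MonoidAlgebra.sum_coeff_single a]
  refine Subalgebra.sum_mem _ fun x hx => ?_
  rw [← MonoidAlgebra.smul_of]
  refine Subalgebra.smul_mem _ (of_mem_subAlg ?_) _
  by_contra hX
  exact (Finsupp.mem_support_iff.1 hx) (h x hX)

theorem commute_subAlg {X : Subgroup G} {a b : MonoidAlgebra ℚ G} (hb : b ∈ subAlg X)
    (h : ∀ x ∈ X, Commute (MonoidAlgebra.of ℚ G x) a) : Commute b a := by
  induction hb using Algebra.adjoin_induction with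
  | mem x hx => obtain ⟨y, hy, rfl⟩ := hx; exact h y hy
  | algebraMap r => exact Algebra.commutes r a
  | add x y _ _ hx hy => exact hx.add_left hy
  | mul x y _ _ hx hy => exact hx.mul_left hy

theorem of_mul_of_inv (x : G) : MonoidAlgebra.of ℚ G x * MonoidAlgebra.of ℚ G x⁻¹ = 1 := by
  rw [← map_mul, mul_inv_cancel, map_one]

theorem of_inv_mul_of (x : G) : MonoidAlgebra.of ℚ G x⁻¹ * MonoidAlgebra.of ℚ G x = 1 := by
  rw [← map_mul, inv_mul_cancel, map_one]

/-- Conjugation by `x` as an endomorphism of the rational group algebra. -/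
def conjHom (x : G) : MonoidAlgebra ℚ G →ₐ[ℚ] MonoidAlgebra ℚ G :=
  AlgHom.ofLinearMap
    (LinearMap.mulRight ℚ (MonoidAlgebra.of ℚ G x) ∘ₗ
      LinearMap.mulLeft ℚ (MonoidAlgebra.of ℚ G x⁻¹))
    (by simp only [LinearMap.comp_apply, LinearMap.mulLeft_apply, LinearMap.mulRight_apply,
          mul_one, of_inv_mul_of])
    (fun a b => by
      simp only [LinearMap.comp_apply, LinearMap.mulLeft_apply, LinearMap.mulRight_apply]
      calc _ = MonoidAlgebra.of ℚ G x⁻¹ * a * 1 * b * MonoidAlgebra.of ℚ G x := by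
            rw [mul_one]; simp only [mul_assoc]
        _ = _ := by rw [← of_mul_of_inv x]; simp only [mul_assoc])

theorem conjHom_apply (x : G) (a : MonoidAlgebra ℚ G) : conjHom x a = conj a x := rfl

theorem conj_mul (a b : MonoidAlgebra ℚ G) (x : G) : conj (a * b) x = conj a x * conj b x :=
  map_mul (conjHom x) a b

theorem conj_sub (a b : MonoidAlgebra ℚ G) (x : G) : conj (a - b) x = conj a x - conj b x :=
  map_sub (conjHom x) a b

theorem conj_zero (x : G) : conj (0 : MonoidAlgebra ℚ G) x = 0 := map_zero (conjHom x)

theorem conj_smul (r : ℚ) (a : MonoidAlgebra ℚ G) (x : G) : conj (r • a) x = r • conj a x :=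
  map_smul (conjHom x) r a

theorem conj_sum {ι : Type*} (s : Finset ι) (f : ι → MonoidAlgebra ℚ G) (x : G) :
    conj (∑ i ∈ s, f i) x = ∑ i ∈ s, conj (f i) x :=
  map_sum (conjHom x) f s

theorem conj_of (g x : G) :
    conj (MonoidAlgebra.of ℚ G g) x = MonoidAlgebra.of ℚ G (x⁻¹ * g * x) := by
  simp only [conj, map_mul]

theorem conj_conj (a : MonoidAlgebra ℚ G) (x y : G) : conj (conj a x) y = conj a (x * y) := by
  simp only [conj, mul_inv_rev, map_mul, mul_assoc]

theorem conj_one (a : MonoidAlgebra ℚ G) : conj a 1 = a := by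
  rw [conj, inv_one, map_one, one_mul, mul_one]

theorem conj_conj_inv (a : MonoidAlgebra ℚ G) (x : G) : conj (conj a x) x⁻¹ = a := by
  rw [conj_conj, mul_inv_cancel, conj_one]

theorem conj_inv_conj (a : MonoidAlgebra ℚ G) (x : G) : conj (conj a x⁻¹) x = a := by
  rw [conj_conj, inv_mul_cancel, conj_one]

theorem conj_eq_self_iff {a : MonoidAlgebra ℚ G} {x : G} :
    conj a x = a ↔ Commute (MonoidAlgebra.of ℚ G x) a := by
  constructor
  · intro h
    have : MonoidAlgebra.of ℚ G x * conj a x = MonoidAlgebra.of ℚ G x * a := by rw [h]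
    rw [conj, ← mul_assoc, ← mul_assoc, of_mul_of_inv, one_mul] at this
    exact this.symm
  · intro h
    rw [conj, mul_assoc, ← h.eq, ← mul_assoc, of_inv_mul_of, one_mul]

theorem mem_cen {X : Subgroup G} {a : MonoidAlgebra ℚ G} {x : G} :
    x ∈ cen X a ↔ x ∈ X ∧ conj a x = a := by
  rw [conj_eq_self_iff]; rfl

theorem conj_mem_subAlg {X Y : Subgroup G} {x : G} (h : ∀ g ∈ X, x⁻¹ * g * x ∈ Y)
    {a : MonoidAlgebra ℚ G} (ha : a ∈ subAlg X) : conj a x ∈ subAlg Y := by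
  rw [← conjHom_apply]
  induction ha using Algebra.adjoin_induction with
  | mem z hz =>
    obtain ⟨y, hy, rfl⟩ := hz
    rw [conjHom_apply, conj_of]
    exact of_mem_subAlg (h y hy)
  | algebraMap r => rw [AlgHom.commutes]; exact Subalgebra.algebraMap_mem _ r
  | add x y _ _ hx hy => rw [map_add]; exact add_mem hx hy
  | mul x y _ _ hx hy => rw [map_mul]; exact mul_mem hx hy

theorem inv_mul_mul_mem {X : Subgroup G} {x : G} (hx : x ∈ Subgroup.normalizer (X : Set G))
    {g : G} (hg : g ∈ X) : x⁻¹ * g * x ∈ X := by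
  simpa using (Subgroup.mem_normalizer_iff.1 (inv_mem hx) g).1 hg

theorem mul_mul_inv_mem {X : Subgroup G} {x : G} (hx : x ∈ Subgroup.normalizer (X : Set G))
    {g : G} (hg : g ∈ X) : x * g * x⁻¹ ∈ X :=
  (Subgroup.mem_normalizer_iff.1 hx g).1 hg

/-- The linear extension to the rational group algebra of a function on the group. -/
def linExt {V : Type*} [AddCommGroup V] [Module ℚ V] (f : G → V) : MonoidAlgebra ℚ G →ₗ[ℚ] V :=
  Finsupp.linearCombination ℚ f ∘ₗ (MonoidAlgebra.coeffLinearEquiv ℚ).toLinearMap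

theorem linExt_of {V : Type*} [AddCommGroup V] [Module ℚ V] (f : G → V) (x : G) : linExt f (MonoidAlgebra.of ℚ G x) = f x := by
  simp [linExt]

theorem linMap_ext {V : Type*} [AddCommGroup V] [Module ℚ V] {φ ψ : MonoidAlgebra ℚ G →ₗ[ℚ] V}
    (h : ∀ x, φ (MonoidAlgebra.of ℚ G x) = ψ (MonoidAlgebra.of ℚ G x)) : φ = ψ := by
  ext x
  exact h x

/-! ### Linear characters and their extensions to the group algebra -/

section ext

variable {A : Subgroup G} (θ : A →* ℂˣ)

theorem ext_of_mem {g : G} (hg : g ∈ A) : ext θ g = (θ ⟨g, hg⟩ : ℂ) := by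
  simp [ext, hg]

theorem ext_of_notMem {g : G} (hg : g ∉ A) : ext θ g = 0 := by
  simp [ext, hg]

theorem ext_ne_zero_iff {g : G} : ext θ g ≠ 0 ↔ g ∈ A := by
  by_cases hg : g ∈ A
  · simp [ext_of_mem θ hg, hg]
  · simp [ext_of_notMem θ hg, hg]

theorem ext_one : ext θ 1 = 1 := by
  rw [ext_of_mem θ A.one_mem]
  have : (⟨1, A.one_mem⟩ : A) = 1 := rfl
  simp [this]

theorem ext_mul_left {a : G} (ha : a ∈ A) (g : G) : ext θ (a * g) = ext θ a * ext θ g := by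
  by_cases hg : g ∈ A
  · rw [ext_of_mem θ ha, ext_of_mem θ hg, ext_of_mem θ (mul_mem ha hg), ← Units.val_mul,
      ← map_mul]
    rfl
  · rw [ext_of_notMem θ hg, mul_zero, ext_of_notMem]
    rwa [Subgroup.mul_mem_cancel_left _ ha]

theorem mem_kerIn {g : G} : g ∈ kerIn θ ↔ ext θ g = 1 := by
  constructor
  · rintro ⟨x, hx, rfl⟩
    rw [Subgroup.coe_subtype, ext_of_mem θ x.2]
    simpa using hx
  · intro h
    have hg : g ∈ A := (ext_ne_zero_iff θ).1 (by rw [h]; exact one_ne_zero)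
    refine ⟨⟨g, hg⟩, ?_, rfl⟩
    rw [ext_of_mem θ hg] at h
    simpa using h

theorem kerIn_le : kerIn θ ≤ A := by
  rintro _ ⟨x, -, rfl⟩
  exact x.2

/-- Left translation by `A` preserves both `A` and its complement, where the character is read as
zero, so the right factor need not lie in `ℚA`. -/
theorem linExt_mul {a : MonoidAlgebra ℚ G} (ha : a ∈ subAlg A) (b : MonoidAlgebra ℚ G) :
    linExt (ext θ) (a * b) = linExt (ext θ) a * linExt (ext θ) b := by
  induction ha using Algebra.adjoin_induction generalizing b with
  | mem z hz =>
    obtain ⟨y, hy, rfl⟩ := hz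
    have : linExt (ext θ) ∘ₗ LinearMap.mulLeft ℚ (MonoidAlgebra.of ℚ G y) =
        ext θ y • linExt (ext θ) := by
      refine linMap_ext fun x => ?_
      rw [LinearMap.comp_apply, LinearMap.mulLeft_apply, ← map_mul, linExt_of, LinearMap.smul_apply,
        linExt_of, ext_mul_left θ hy, smul_eq_mul]
    simpa only [LinearMap.comp_apply, LinearMap.mulLeft_apply, LinearMap.smul_apply, smul_eq_mul,
      linExt_of] using LinearMap.congr_fun this b
  | algebraMap r =>
    rw [Algebra.algebraMap_eq_smul_one, smul_mul_assoc, one_mul, map_smul, map_smul,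
      MonoidAlgebra.one_def, ← MonoidAlgebra.of_apply, linExt_of, ext_one, smul_mul_assoc, one_mul]
  | add x y _ _ hx hy => rw [add_mul, map_add, map_add, hx, hy, add_mul]
  | mul x y _ _ hx hy => rw [mul_assoc, hx, hy, hx, mul_assoc]

theorem linExt_one : linExt (ext θ) 1 = 1 := by
  rw [← map_one (MonoidAlgebra.of ℚ G), linExt_of, ext_one]

end ext

section

/-! ## The idempotent `ε(A, ker θ)` of a linear character `θ` of `A` -/

section hat

variable [Finite G]

theorem hat_mem_subAlg (H : Subgroup G) : hat H ∈ subAlg H :=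
  Subalgebra.smul_mem _ (Subalgebra.sum_mem _ fun _ hx => of_mem_subAlg (mem_elems.1 hx)) _

theorem card_elems (H : Subgroup G) : (elems H).card = Nat.card H := by
  rw [elems, ← Set.ncard_eq_toFinset_card]
  rfl

theorem card_subgroup_ne_zero (H : Subgroup G) : (Nat.card H : ℚ) ≠ 0 :=
  Nat.cast_ne_zero.2 Nat.card_pos.ne'

theorem hat_mul_of_forall {H : Subgroup G} {b : MonoidAlgebra ℚ G}
    (h : ∀ x ∈ H, MonoidAlgebra.of ℚ G x * b = b) : hat H * b = b := by
  rw [hat, smul_mul_assoc, Finset.sum_mul, Finset.sum_congr rfl fun x hx => h x (mem_elems.1 hx),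
    Finset.sum_const, card_elems, ← Nat.cast_smul_eq_nsmul ℚ, smul_smul,
    inv_mul_cancel₀ (card_subgroup_ne_zero H), one_smul]

theorem of_mul_hat {H : Subgroup G} {x : G} (hx : x ∈ H) :
    MonoidAlgebra.of ℚ G x * hat H = hat H := by
  rw [hat, mul_smul_comm, Finset.mul_sum]
  congr 1
  refine Finset.sum_bij' (fun g _ => x * g) (fun g _ => x⁻¹ * g) ?_ ?_ ?_ ?_ ?_
  · exact fun g hg => mem_elems.2 (mul_mem hx (mem_elems.1 hg))
  · exact fun g hg => mem_elems.2 (mul_mem (inv_mem hx) (mem_elems.1 hg))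
  · exact fun g _ => inv_mul_cancel_left x g
  · exact fun g _ => mul_inv_cancel_left x g
  · exact fun g _ => (map_mul _ _ _).symm

theorem hat_mul_hat {L M : Subgroup G} (h : L ≤ M) : hat L * hat M = hat M :=
  hat_mul_of_forall fun _ hx => of_mul_hat (h hx)

end hat

variable {A : Subgroup G} (θ : A →* ℂˣ)

theorem ext_inv_mul {a : G} (ha : a ∈ A) : ext θ a⁻¹ * ext θ a = 1 := by
  rw [← ext_mul_left θ (inv_mem ha), inv_mul_cancel, ext_one]

theorem ext_pow {h : G} (hh : h ∈ A) (j : ℕ) : ext θ (h ^ j) = ext θ h ^ j := by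
  induction j with
  | zero => simp [ext_one]
  | succ j ih => rw [pow_succ', pow_succ', ext_mul_left θ hh, ih]

open Polynomial in
theorem aeval_mem_subAlg {h : G} (hh : h ∈ A) (p : ℚ[X]) :
    aeval (MonoidAlgebra.of ℚ G h) p ∈ subAlg A :=
  Algebra.adjoin_mono (Set.singleton_subset_iff.2 (Set.mem_image_of_mem _ hh))
    (aeval_mem_adjoin_singleton ℚ (MonoidAlgebra.of ℚ G h))

/-- The elements of `G` that fix `b` by left multiplication. -/
def leftStab (b : MonoidAlgebra ℚ G) : Subgroup G where
  carrier := {x | MonoidAlgebra.of ℚ G x * b = b}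
  one_mem' := by rw [Set.mem_ofPred_eq, map_one, one_mul]
  mul_mem' := fun {x y} hx hy => by
    rw [Set.mem_ofPred_eq] at *
    rw [map_mul, mul_assoc, hy, hx]
  inv_mem' := fun {x} hx => by
    rw [Set.mem_ofPred_eq] at *
    nth_rewrite 1 [← hx]
    rw [← mul_assoc, of_inv_mul_of, one_mul]

theorem mem_leftStab {b : MonoidAlgebra ℚ G} {x : G} :
    x ∈ leftStab b ↔ MonoidAlgebra.of ℚ G x * b = b := Iff.rfl

/-- The quotient of `A` by the kernel embeds in `ℂˣ`, hence is abelian. So normality in the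
definition of `minOver` is automatic over a kernel. -/
theorem le_normalizer_of_kerIn_le {L : Subgroup G} (h1 : kerIn θ ≤ L) (h2 : L ≤ A) :
    A ≤ Subgroup.normalizer (L : Set G) := by
  have key : ∀ a ∈ A, ∀ l ∈ L, a * l * a⁻¹ ∈ L := by
    intro a ha l hl
    have : a * l * a⁻¹ * l⁻¹ ∈ kerIn θ := by
      rw [mem_kerIn, mul_assoc, mul_assoc, ext_mul_left θ ha, ext_mul_left θ (h2 hl),
        ext_mul_left θ (inv_mem ha)]
      calc _ = (ext θ a⁻¹ * ext θ a) * (ext θ l⁻¹ * ext θ l) := by ring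
        _ = 1 := by rw [ext_inv_mul θ ha, ext_inv_mul θ (h2 hl), one_mul]
    simpa using mul_mem (h1 this) hl
  intro a ha
  rw [Subgroup.mem_normalizer_iff]
  refine fun l => ⟨key a ha l, fun hl => ?_⟩
  simpa [mul_assoc] using key a⁻¹ (inv_mem ha) _ hl

/-- `F` is the primitive central idempotent of the rational group algebra of `A` that belongs to
the linear character `θ`. -/
structure IsCharIdem (F : MonoidAlgebra ℚ G) : Prop where
  mem : F ∈ subAlg A
  comm : ∀ x ∈ A, Commute (MonoidAlgebra.of ℚ G x) F
  linExt_eq : linExt (ext θ) F = 1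
  mul_eq_zero : ∀ a ∈ subAlg A, linExt (ext θ) a = 0 → a * F = 0

section eps

variable [Finite G]

theorem linExt_hat_kerIn : linExt (ext θ) (hat (kerIn θ)) = 1 := by
  rw [hat, map_smul, map_sum, Finset.sum_congr rfl fun x hx => by
    rw [linExt_of, (mem_kerIn θ).1 (mem_elems.1 hx)], Finset.sum_const, card_elems, nsmul_eq_mul,
    mul_one, Rat.smul_def]
  push_cast
  exact inv_mul_cancel₀ (Nat.cast_ne_zero.2 Nat.card_pos.ne')

/-- An element `l` of `L` outside the kernel fixes `hat L`, so the value at `hat L` is unchanged by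
a factor different from 1. -/
theorem linExt_hat_eq_zero {L : Subgroup G} (h1 : kerIn θ < L) (h2 : L ≤ A) :
    linExt (ext θ) (hat L) = 0 := by
  obtain ⟨l, hl, hl'⟩ := SetLike.exists_of_lt h1
  have := linExt_mul θ (of_mem_subAlg (h2 hl)) (hat L)
  rw [of_mul_hat hl, linExt_of] at this
  by_contra h0
  exact hl' ((mem_kerIn θ).2 (mul_right_cancel₀ h0 (by rw [← this, one_mul])))

theorem minOver_exists_le {L : Subgroup G} (h1 : kerIn θ < L) (h2 : L ≤ A) :
    ∃ M ∈ minOver A (kerIn θ), M ≤ L := by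
  obtain ⟨M, hM, hM'⟩ := exists_minimal_le_of_wellFoundedLT
    (fun M : Subgroup G => M ≤ A ∧ A ≤ Subgroup.normalizer (M : Set G) ∧ kerIn θ < M) L
    ⟨h2, le_normalizer_of_kerIn_le θ h1.le h2, h1⟩
  exact ⟨M, hM', hM⟩

theorem eps_mem_and_linExt : eps A (kerIn θ) ∈ subAlg A ∧
    (∀ x ∈ A, Commute (MonoidAlgebra.of ℚ G x) (eps A (kerIn θ))) ∧
    linExt (ext θ) (eps A (kerIn θ)) = 1 := by
  have hK : hat (kerIn θ) ∈ subAlg A := subAlg_mono (kerIn_le θ) (hat_mem_subAlg _)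
  have hKc : ∀ x ∈ A, Commute (MonoidAlgebra.of ℚ G x) (hat (kerIn θ)) := fun x hx =>
    of_commute_hat (le_normalizer_of_kerIn_le θ le_rfl (kerIn_le θ) hx)
  unfold eps
  split_ifs with h
  · exact ⟨hK, hKc, linExt_hat_kerIn θ⟩
  · refine Finset.noncommProd_induction _ _ _ (fun b => b ∈ subAlg A ∧
      (∀ x ∈ A, Commute (MonoidAlgebra.of ℚ G x) b) ∧ linExt (ext θ) b = 1) ?_ ?_ ?_
    · rintro a b ⟨ha1, ha2, ha3⟩ ⟨hb1, hb2, hb3⟩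
      exact ⟨mul_mem ha1 hb1, fun x hx => (ha2 x hx).mul_right (hb2 x hx), by
        rw [linExt_mul θ ha1, ha3, hb3, one_mul]⟩
    · exact ⟨one_mem _, fun x _ => Commute.one_right _, linExt_one θ⟩
    · intro L hL
      rw [Set.Finite.mem_toFinset] at hL
      have hL := hL.1
      refine ⟨sub_mem hK (subAlg_mono hL.1 (hat_mem_subAlg _)), fun x hx =>
        (hKc x hx).sub_right (of_commute_hat (hL.2.1 hx)), ?_⟩
      rw [map_sub, linExt_hat_kerIn, linExt_hat_eq_zero θ hL.2.2 hL.1, sub_zero]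

open Classical in
theorem exists_eps_eq {L : Subgroup G} (hL : L ∈ minOver A (kerIn θ)) :
    ∃ b, eps A (kerIn θ) = (hat (kerIn θ) - hat L) * b := by
  have h : A ≠ kerIn θ := fun h => (hL.1.2.2.trans_le hL.1.1).ne h.symm
  unfold eps
  rw [if_neg h]
  exact ⟨_, (Finset.mul_noncommProd_erase _ ((Set.Finite.mem_toFinset _).2 hL) _ _).symm⟩

theorem of_mul_eps {k : G} (hk : k ∈ kerIn θ) :
    MonoidAlgebra.of ℚ G k * eps A (kerIn θ) = eps A (kerIn θ) := by
  rcases eq_or_lt_of_le (kerIn_le θ) with h | h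
  · have : eps A (kerIn θ) = hat (kerIn θ) := by
      unfold eps
      rw [if_pos h.symm]
    rw [this, of_mul_hat hk]
  · obtain ⟨L, hL, -⟩ := minOver_exists_le θ h le_rfl
    obtain ⟨b, hb⟩ := exists_eps_eq θ hL
    rw [hb, ← mul_assoc, mul_sub, of_mul_hat hk, of_mul_hat (hL.1.2.2.le hk)]

/-- `L` contains some minimal `M`, and `hat L` absorbs both terms of the factor of `ε` belonging to
`M`. -/
theorem hat_mul_eps {L : Subgroup G} (h1 : kerIn θ < L) (h2 : L ≤ A) :
    hat L * eps A (kerIn θ) = 0 := by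
  obtain ⟨M, hM, hML⟩ := minOver_exists_le θ h1 h2
  obtain ⟨b, hb⟩ := exists_eps_eq θ hM
  have hc : ∀ {M : Subgroup G}, M ≤ L → M ≤ A → hat L * hat M = hat L := fun {M} h h' => by
    rw [← (hat_commute_hat (h'.trans (le_normalizer_of_kerIn_le θ h1.le h2))).eq, hat_mul_hat h]
  rw [hb, ← mul_assoc, mul_sub, hc h1.le (kerIn_le θ), hc hML (hML.trans h2), sub_self, zero_mul]

/-- The image of the character is a finite subgroup of `ℂˣ`, hence cyclic; finite order allows
natural exponents. -/
theorem exists_generator : ∃ (m : ℕ) (h : G), 0 < m ∧ h ∈ A ∧ IsPrimitiveRoot (ext θ h) m ∧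
    ∀ a ∈ A, ∃ j : ℕ, ext θ a = ext θ h ^ j := by
  have : Finite θ.range := inferInstanceAs (Finite (Set.range θ))
  obtain ⟨⟨_, h, rfl⟩, hg⟩ := IsCyclic.exists_generator (α := θ.range)
  have hfin : IsOfFinOrder (θ h) := MonoidHom.isOfFinOrder θ (isOfFinOrder_of_finite h)
  refine ⟨orderOf (θ h), h, hfin.orderOf_pos, h.2, ?_, fun a ha => ?_⟩
  · rw [ext_of_mem θ h.2]
    exact (IsPrimitiveRoot.orderOf (θ h)).map_of_injective (f := Units.coeHom ℂ)
      Units.val_injective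
  · obtain ⟨j, hj⟩ := hg ⟨θ ⟨a, ha⟩, ⟨a, ha⟩, rfl⟩
    have hj : θ h ^ j = θ ⟨a, ha⟩ := congrArg Subtype.val hj
    obtain ⟨n, hn⟩ := hfin.mem_powers_iff_mem_zpowers.2 ⟨j, hj⟩
    refine ⟨n, ?_⟩
    rw [ext_of_mem θ ha, ext_of_mem θ h.2]
    exact_mod_cast congrArg Units.val hn.symm

open Polynomial in
-- A rational polynomial vanishing at the primitive `m`-th root of unity is a multiple of the `m`-th
-- cyclotomic polynomial, so it suffices that the latter, evaluated at `h`, kills `ε`. This is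
-- extracted from `h ^ m - 1` by cancelling the other cyclotomic factors.
theorem aeval_mul_eps {m : ℕ} {h : G} (hm : 0 < m) (hh : h ∈ A)
    (hprim : IsPrimitiveRoot (ext θ h) m) {p : ℚ[X]} (hp : aeval (ext θ h) p = 0) :
    aeval (MonoidAlgebra.of ℚ G h) p * eps A (kerIn θ) = 0 := by
  set E := eps A (kerIn θ)
  set u := MonoidAlgebra.of ℚ G h
  obtain ⟨hE1, hE2, -⟩ := eps_mem_and_linExt θ
  have hsmul : ∀ q r : ℚ[X], aeval u r * E = 0 → aeval u (q * r) * E = 0 := fun q r hr => by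
    rw [map_mul, mul_assoc, hr, mul_zero]
  have hdvd : ∀ q r : ℚ[X], q ∣ r → aeval u q * E = 0 → aeval u r * E = 0 := by
    rintro q _ ⟨s, rfl⟩ hr
    rw [mul_comm]
    exact hsmul _ _ hr
  have hk : h ^ m ∈ kerIn θ := by rw [mem_kerIn, ext_pow θ hh, hprim.pow_eq_one]
  have hX : aeval u (X ^ m - 1 : ℚ[X]) * E = 0 := by
    rw [map_sub, map_pow, aeval_X, map_one, ← map_pow, sub_mul, of_mul_eps θ hk, one_mul, sub_self]
  -- the sum over a subgroup of prime order modulo the kernel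
  have hgeom : ∀ q d : ℕ, q.Prime → q * d = m →
      aeval u (∑ j ∈ Finset.range q, (X ^ d) ^ j : ℚ[X]) * E = 0 := by
    intro q d hq hqd
    set s : ℚ[X] := ∑ j ∈ Finset.range q, (X ^ d) ^ j
    have hd : 0 < d := Nat.pos_of_ne_zero fun h0 => by simp [h0] at hqd; omega
    have hs : (X ^ d - 1) * s = X ^ m - 1 := by
      rw [mul_geom_sum, ← pow_mul, mul_comm d q, hqd]
    let L : Subgroup G := kerIn θ ⊔ Subgroup.zpowers (h ^ d)
    have hL1 : kerIn θ < L := by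
      refine lt_of_le_of_ne le_sup_left fun hL => ?_
      have : h ^ d ∈ kerIn θ := by
        rw [hL]
        exact (le_sup_right : Subgroup.zpowers (h ^ d) ≤ L) (Subgroup.mem_zpowers _)
      rw [mem_kerIn, ext_pow θ hh] at this
      have hle := Nat.le_of_dvd hd (hprim.dvd_of_pow_eq_one d this)
      rw [← hqd] at hle
      nlinarith [hq.two_le]
    have hL2 : L ≤ A := sup_le (kerIn_le θ) (Subgroup.zpowers_le.2 (pow_mem hh d))
    have hu : aeval u s ∈ subAlg A :=
      aeval_mem_subAlg hh s
    have hsE : Commute (aeval u s) E := commute_subAlg hu hE2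
    -- Multiplying `s` by `X ^ d` adds only `X ^ m - 1`, which kills `E`. So all of `L` fixes `s(u)
    -- E`; averaging over `L` changes nothing, yet `hat L` annihilates `E`.
    have hinv : hat L * (aeval u s * E) = aeval u s * E := by
      suffices hL : L ≤ leftStab (aeval u s * E) from
        hat_mul_of_forall fun x hx => mem_leftStab.1 (hL hx)
      refine sup_le (fun k hk => ?_) (Subgroup.zpowers_le.2 ?_)
      · rw [mem_leftStab, hsE.eq, ← mul_assoc, of_mul_eps θ hk]
      · have h1 : MonoidAlgebra.of ℚ G (h ^ d) = aeval u (X ^ d : ℚ[X]) := by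
          rw [map_pow, map_pow, aeval_X]
        have h2 : (X ^ d : ℚ[X]) * s = s + (X ^ m - 1) := by rw [← hs]; ring
        rw [mem_leftStab, h1, ← mul_assoc, ← map_mul, h2, map_add, add_mul, hX, add_zero]
    have hz : Commute (hat L) (aeval u s) := by
      refine (commute_subAlg hu fun x hx => of_commute_hat
        (le_normalizer_of_kerIn_le θ hL1.le hL2 hx)).symm
    rw [← hinv, ← mul_assoc, hz.eq, mul_assoc, hat_mul_eps θ hL1 hL2, mul_zero]
  have hcop : ∀ d ∈ m.properDivisors, ∀ r : ℚ[X],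
      aeval u (cyclotomic d ℚ * r) * E = 0 → aeval u r * E = 0 := by
    intro d hd r hr
    rw [Nat.mem_properDivisors] at hd
    obtain ⟨⟨e, rfl⟩, hlt⟩ := hd
    -- With `q` a prime dividing `m / d`, the `d`-th cyclotomic polynomial divides `X ^ (m / q) -
    -- 1`. This is coprime to the cofactor `s` because `X ^ m - 1` is separable, and a Bézout
    -- relation cancels the factor.
    obtain ⟨q, hq, f, rfl⟩ := Nat.exists_prime_and_dvd (n := e) (by rintro rfl; simp at hlt)
    set s : ℚ[X] := ∑ j ∈ Finset.range q, (X ^ (d * f)) ^ j with hs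
    have h1 : aeval u s * E = 0 := hgeom q (d * f) hq (by ring)
    have h2 : (X ^ (d * f) - 1) * s = X ^ (d * (q * f)) - 1 := by
      rw [mul_geom_sum, ← pow_mul]; ring_nf
    have hsep : ((X ^ (d * f) - 1) * s).Separable := by
      rw [h2, X_pow_sub_one_separable_iff]
      exact_mod_cast hm.ne'
    have hc : IsCoprime (cyclotomic d ℚ) s := by
      refine IsCoprime.of_isCoprime_of_dvd_left hsep.isCoprime ?_
      exact (cyclotomic.dvd_X_pow_sub_one d ℚ).trans (by
        simpa [pow_mul] using sub_dvd_pow_sub_pow (X ^ d : ℚ[X]) 1 f)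
    obtain ⟨a, b, hab⟩ := hc
    have : r = a * (cyclotomic d ℚ * r) + (b * r) * s := by
      linear_combination (-r) * hab
    rw [this, map_add, add_mul, hsmul _ _ hr, hsmul _ _ h1, add_zero]
  have hcyc : aeval u (cyclotomic m ℚ) * E = 0 := by
    have : ∀ S : Finset ℕ, S ⊆ m.properDivisors →
        aeval u ((∏ d ∈ S, cyclotomic d ℚ) * cyclotomic m ℚ) * E = 0 →
        aeval u (cyclotomic m ℚ) * E = 0 := by
      intro S
      induction S using Finset.induction_on with
      | empty => intro _ h; simpa using h
      | insert d S hd ih =>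
        intro hS h
        rw [Finset.prod_insert hd, mul_assoc] at h
        exact ih (fun x hx => hS (Finset.mem_insert_of_mem hx))
          (hcop d (hS (Finset.mem_insert_self _ _)) _ h)
    refine this _ subset_rfl ?_
    rw [mul_comm, ← Finset.prod_insert (f := fun d => cyclotomic d ℚ) Nat.self_notMem_properDivisors,
      Nat.insert_self_properDivisors hm.ne', prod_cyclotomic_eq_X_pow_sub_one hm]
    exact hX
  refine hdvd _ _ ?_ hcyc
  rw [cyclotomic_eq_minpoly_rat hprim hm]
  exact minpoly.dvd _ _ hp

open Polynomial in
-- Modulo the kernel, which `ε` absorbs, every element of `A` is a power of one `h`. Hence each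
-- element of `ℚA` acts on `ε` as a rational polynomial in `h`, and the claim reduces to
-- `aeval_mul_eps`.
theorem isCharIdem_eps : IsCharIdem θ (eps A (kerIn θ)) := by
  obtain ⟨hE1, hE2, hE3⟩ := eps_mem_and_linExt θ
  refine ⟨hE1, hE2, hE3, fun a ha h0 => ?_⟩
  obtain ⟨m, h, hm, hh, hprim, hgen⟩ := exists_generator θ
  obtain ⟨p, hp1, hp2⟩ : ∃ p : ℚ[X], aeval (ext θ h) p = linExt (ext θ) a ∧
      aeval (MonoidAlgebra.of ℚ G h) p * eps A (kerIn θ) = a * eps A (kerIn θ) := by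
    clear h0
    induction ha using Algebra.adjoin_induction with
    | mem z hz =>
      obtain ⟨x, hx, rfl⟩ := hz
      obtain ⟨j, hj⟩ := hgen x hx
      refine ⟨X ^ j, by rw [linExt_of, map_pow, aeval_X, hj], ?_⟩
      have hk : (h ^ j)⁻¹ * x ∈ kerIn θ := by
        rw [mem_kerIn, ext_mul_left θ (inv_mem (pow_mem hh j)), hj, ← ext_pow θ hh,
          ext_inv_mul θ (pow_mem hh j)]
      rw [map_pow, aeval_X, ← of_mul_eps θ hk, ← mul_assoc, ← map_pow, ← map_mul,
        mul_inv_cancel_left, of_mul_eps θ hk]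
    | algebraMap r =>
      refine ⟨C r, ?_, by simp⟩
      rw [Algebra.algebraMap_eq_smul_one, map_smul, linExt_one, aeval_C,
        Algebra.algebraMap_eq_smul_one]
    | add x y _ _ hx hy =>
      obtain ⟨p, hp1, hp2⟩ := hx
      obtain ⟨q, hq1, hq2⟩ := hy
      exact ⟨p + q, by rw [map_add, map_add, hp1, hq1],
        by rw [map_add, add_mul, add_mul, hp2, hq2]⟩
    | mul x y hx' hy' hx hy =>
      obtain ⟨p, hp1, hp2⟩ := hx
      obtain ⟨q, hq1, hq2⟩ := hy
      refine ⟨p * q, by rw [map_mul, linExt_mul θ hx', hp1, hq1], ?_⟩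
      have hc : Commute (aeval (MonoidAlgebra.of ℚ G h) q) (eps A (kerIn θ)) :=
        commute_subAlg (aeval_mem_subAlg hh q) hE2
      rw [map_mul, mul_assoc, hc.eq, ← mul_assoc, hp2, mul_assoc, ← hc.eq, hq2, mul_assoc]
  rw [← hp2]
  exact aeval_mul_eps θ hm hh hprim (hp1.trans h0)

end eps

end

/-! ## Restriction of coefficients to a subgroup -/

open Classical in
/-- Restriction of the coefficients of an element of the group algebra to a subgroup. -/
def proj (X : Subgroup G) : MonoidAlgebra ℚ G →ₗ[ℚ] MonoidAlgebra ℚ G :=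
  linExt fun x => if x ∈ X then MonoidAlgebra.of ℚ G x else 0

theorem proj_of_mem {X : Subgroup G} {x : G} (hx : x ∈ X) :
    proj X (MonoidAlgebra.of ℚ G x) = MonoidAlgebra.of ℚ G x := by
  rw [proj, linExt_of, if_pos hx]

theorem proj_of_notMem {X : Subgroup G} {x : G} (hx : x ∉ X) :
    proj X (MonoidAlgebra.of ℚ G x) = 0 := by
  rw [proj, linExt_of, if_neg hx]

theorem proj_of_mul {X : Subgroup G} {x : G} (hx : x ∈ X) (a : MonoidAlgebra ℚ G) :
    proj X (MonoidAlgebra.of ℚ G x * a) = MonoidAlgebra.of ℚ G x * proj X a := by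
  have : proj X ∘ₗ LinearMap.mulLeft ℚ (MonoidAlgebra.of ℚ G x) =
      LinearMap.mulLeft ℚ (MonoidAlgebra.of ℚ G x) ∘ₗ proj X := by
    refine linMap_ext fun y => ?_
    simp only [LinearMap.comp_apply, LinearMap.mulLeft_apply]
    by_cases hy : y ∈ X
    · rw [← map_mul, proj_of_mem (mul_mem hx hy), proj_of_mem hy, map_mul]
    · rw [← map_mul, proj_of_notMem (by rwa [Subgroup.mul_mem_cancel_left _ hx]),
        proj_of_notMem hy, mul_zero]
  exact LinearMap.congr_fun this a

theorem proj_mul_of {X : Subgroup G} {x : G} (hx : x ∈ X) (a : MonoidAlgebra ℚ G) :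
    proj X (a * MonoidAlgebra.of ℚ G x) = proj X a * MonoidAlgebra.of ℚ G x := by
  have : proj X ∘ₗ LinearMap.mulRight ℚ (MonoidAlgebra.of ℚ G x) =
      LinearMap.mulRight ℚ (MonoidAlgebra.of ℚ G x) ∘ₗ proj X := by
    refine linMap_ext fun y => ?_
    simp only [LinearMap.comp_apply, LinearMap.mulRight_apply]
    by_cases hy : y ∈ X
    · rw [← map_mul, proj_of_mem (mul_mem hy hx), proj_of_mem hy, map_mul]
    · rw [← map_mul, proj_of_notMem (by rwa [Subgroup.mul_mem_cancel_right _ hx]),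
        proj_of_notMem hy, zero_mul]
  exact LinearMap.congr_fun this a

theorem proj_mul {X : Subgroup G} {u : MonoidAlgebra ℚ G} (hu : u ∈ subAlg X)
    (a : MonoidAlgebra ℚ G) : proj X (u * a) = u * proj X a := by
  induction hu using Algebra.adjoin_induction generalizing a with
  | mem z hz => obtain ⟨y, hy, rfl⟩ := hz; exact proj_of_mul hy a
  | algebraMap r =>
    rw [Algebra.algebraMap_eq_smul_one, smul_mul_assoc, one_mul, map_smul, smul_mul_assoc, one_mul]
  | add x y _ _ hx hy => rw [add_mul, map_add, hx, hy, add_mul]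
  | mul x y _ _ hx hy => rw [mul_assoc, hx, hy, mul_assoc]

theorem proj_eq_self {X : Subgroup G} {u : MonoidAlgebra ℚ G} (hu : u ∈ subAlg X) :
    proj X u = u := by
  have h1 : proj X (1 : MonoidAlgebra ℚ G) = 1 := by
    rw [← map_one (MonoidAlgebra.of ℚ G), proj_of_mem X.one_mem]
  simpa [h1] using proj_mul hu 1

theorem coeff_proj_of_notMem {X : Subgroup G} {x : G} (hx : x ∉ X) (a : MonoidAlgebra ℚ G) :
    (proj X a).coeff x = 0 := by
  have : (Finsupp.lapply x ∘ₗ (MonoidAlgebra.coeffLinearEquiv ℚ).toLinearMap) ∘ₗ proj X = 0 := by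
    refine linMap_ext fun y => ?_
    by_cases hy : y ∈ X
    · have hxy : y ≠ x := fun h => hx (h ▸ hy)
      simp only [LinearMap.comp_apply, proj_of_mem hy]
      simp [hxy]
    · simp only [LinearMap.comp_apply, proj_of_notMem hy]
      simp
  exact LinearMap.congr_fun this a

theorem coeff_proj_one {X : Subgroup G} (a : MonoidAlgebra ℚ G) :
    (proj X a).coeff 1 = a.coeff 1 := by
  have : (Finsupp.lapply 1 ∘ₗ (MonoidAlgebra.coeffLinearEquiv ℚ).toLinearMap) ∘ₗ proj X =
      Finsupp.lapply 1 ∘ₗ (MonoidAlgebra.coeffLinearEquiv ℚ).toLinearMap := by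
    refine linMap_ext fun y => ?_
    by_cases hy : y ∈ X
    · simp only [LinearMap.comp_apply, proj_of_mem hy]
    · have hy1 : y ≠ 1 := fun h => hy (h ▸ X.one_mem)
      simp only [LinearMap.comp_apply, proj_of_notMem hy]
      simp [hy1]
  exact LinearMap.congr_fun this a

theorem proj_mem_subAlg (X : Subgroup G) (a : MonoidAlgebra ℚ G) : proj X a ∈ subAlg X :=
  mem_subAlg_of_coeff fun _ hx => coeff_proj_of_notMem hx a

/-- The coefficient of `a` at `x` is the coefficient of `a x⁻¹` at 1, which `proj L` keeps. -/
theorem mem_subAlg_of_proj {L M : Subgroup G} {a : MonoidAlgebra ℚ G} (ha : a ∈ subAlg M)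
    (h : ∀ x ∈ M, x ∉ L → proj L (a * MonoidAlgebra.of ℚ G x⁻¹) = 0) : a ∈ subAlg L := by
  refine mem_subAlg_of_coeff fun x hx => ?_
  by_cases hM : x ∈ M
  · have := coeff_proj_one (X := L) (a * MonoidAlgebra.of ℚ G x⁻¹)
    rw [h x hM hx] at this
    simpa using this.symm
  · rw [← proj_eq_self ha, coeff_proj_of_notMem hM]

/-! ## Conjugates of the idempotent of a linear character -/

theorem linExt_conj {V : Type*} [AddCommGroup V] [Module ℚ V] (f : G → V) (x : G)
    (a : MonoidAlgebra ℚ G) : linExt f (conj a x) = linExt (fun g => f (x⁻¹ * g * x)) a := by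
  have : linExt f ∘ₗ (conjHom x).toLinearMap = linExt (fun g => f (x⁻¹ * g * x)) := by
    refine linMap_ext fun g => ?_
    rw [LinearMap.comp_apply, AlgHom.toLinearMap_apply, conjHom_apply, conj_of, linExt_of,
      linExt_of]
  exact LinearMap.congr_fun this a

namespace IsCharIdem

variable {A : Subgroup G} {θ : A →* ℂˣ} {F : MonoidAlgebra ℚ G} (hF : IsCharIdem θ F)

include hF

theorem ne_zero : F ≠ 0 := by
  rintro rfl
  simpa using hF.linExt_eq

theorem mul_eq {a : MonoidAlgebra ℚ G} (ha : a ∈ subAlg A) (h : linExt (ext θ) a = 1) :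
    a * F = F := by
  have := hF.mul_eq_zero (a - 1) (sub_mem ha (one_mem _)) (by rw [map_sub, h, linExt_one, sub_self])
  rwa [sub_mul, one_mul, sub_eq_zero] at this

theorem idem : F * F = F := hF.mul_eq hF.mem hF.linExt_eq

theorem commute {a : MonoidAlgebra ℚ G} (ha : a ∈ subAlg A) : Commute a F :=
  commute_subAlg ha hF.comm

theorem linExt_eq_zero {a : MonoidAlgebra ℚ G} (ha : a ∈ subAlg A) (h : a * F = 0) :
    linExt (ext θ) a = 0 := by
  have := linExt_mul θ ha F
  rw [h, map_zero, hF.linExt_eq, mul_one] at this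
  exact this.symm

theorem conj_mem {x : G} (hx : x ∈ Subgroup.normalizer (A : Set G)) : conj F x ∈ subAlg A :=
  conj_mem_subAlg (fun _ hg => inv_mul_mul_mem hx hg) hF.mem

theorem conj_mul_eq_zero_or {x : G} (hx : x ∈ Subgroup.normalizer (A : Set G)) :
    conj F x * F = 0 ∨ conj F x * F = F := by
  have h1 := linExt_mul θ (hF.conj_mem hx) (conj F x)
  rw [← conj_mul, hF.idem] at h1
  rcases eq_or_ne (linExt (ext θ) (conj F x)) 0 with h0 | h0
  · exact Or.inl (hF.mul_eq_zero _ (hF.conj_mem hx) h0)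
  · exact Or.inr (hF.mul_eq (hF.conj_mem hx) (mul_left_cancel₀ h0 (by rw [← h1, mul_one])))

/-- The dichotomy `conj_mul_eq_zero_or` is asymmetric. Applying it to `x` and to `x⁻¹`, and
conjugating the second outcome by `x`, gives either orthogonality or absorption in both directions.
-/
theorem conj_eq_or {x : G} (hx : x ∈ Subgroup.normalizer (A : Set G)) :
    conj F x = F ∨ conj F x * F = 0 := by
  rcases hF.conj_mul_eq_zero_or hx with h | h
  · exact Or.inr h
  · have key : ∀ b, conj F x⁻¹ * F = b → F * conj F x = conj b x := fun b hb => by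
      rw [← hb, conj_mul, conj_inv_conj]
    rcases hF.conj_mul_eq_zero_or (inv_mem hx) with h' | h'
    · right
      rw [(hF.commute (hF.conj_mem hx)).eq, key _ h', conj_zero]
    · left
      rw [← key _ h', ← (hF.commute (hF.conj_mem hx)).eq, h]

theorem conj_eq_of_linExt {x : G} (hx : x ∈ Subgroup.normalizer (A : Set G))
    (h : linExt (ext θ) (conj F x) = 1) : conj F x = F := by
  refine (hF.conj_eq_or hx).resolve_right fun h0 => hF.ne_zero ?_
  rw [← hF.mul_eq (hF.conj_mem hx) h, h0]

theorem conj_eq_of_invariant {x : G} (hx : x ∈ Subgroup.normalizer (A : Set G))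
    (h : ∀ g, ext θ (x * g * x⁻¹) = ext θ g) : conj F x = F := by
  refine hF.conj_eq_of_linExt hx ?_
  have hfun : (fun g => ext θ (x⁻¹ * g * x)) = ext θ := by
    funext g
    rw [← h]
    simp [mul_assoc]
  rw [linExt_conj, hfun, hF.linExt_eq]

theorem linExt_conj_eq_zero {x : G} (hx : x ∈ Subgroup.normalizer (A : Set G))
    (h : conj F x = F) {a : MonoidAlgebra ℚ G} (ha : a ∈ subAlg A) (h0 : linExt (ext θ) a = 0) :
    linExt (ext θ) (conj a x) = 0 := by
  refine hF.linExt_eq_zero (conj_mem_subAlg (fun _ hg => inv_mul_mul_mem hx hg) ha) ?_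
  nth_rewrite 1 [← h]
  rw [← conj_mul, hF.mul_eq_zero a ha h0, conj_zero]

/-- Fixing `F` means preserving the annihilator of `F` in `ℚA`, which is the kernel of the extended
character. This expresses that the conjugate character is a Galois conjugate without naming an
automorphism. -/
theorem ext_conj_eq {x : G} (hx : x ∈ Subgroup.normalizer (A : Set G))
    (h : conj F x = F) {a b : G} (ha : a ∈ A) (hb : b ∈ A) (hab : ext θ a = ext θ b) :
    ext θ (x⁻¹ * a * x) = ext θ (x⁻¹ * b * x) := by
  have := hF.linExt_conj_eq_zero hx h (sub_mem (of_mem_subAlg ha) (of_mem_subAlg hb))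
    (by rw [map_sub, linExt_of, linExt_of, hab, sub_self])
  rwa [conj_sub, conj_of, conj_of, map_sub, linExt_of, linExt_of, sub_eq_zero] at this

omit hF in
theorem conj_inv_eq {x : G} (h : conj F x = F) : conj F x⁻¹ = F := by
  nth_rewrite 1 [← h]
  rw [conj_conj_inv]

theorem mem_normalizer_kerIn {x : G} (hx : x ∈ Subgroup.normalizer (A : Set G))
    (h : conj F x = F) : x ∈ Subgroup.normalizer (kerIn θ : Set G) := by
  have key : ∀ x : G, x ∈ Subgroup.normalizer (A : Set G) → conj F x = F → ∀ k ∈ kerIn θ,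
      x⁻¹ * k * x ∈ kerIn θ := by
    intro x hx h k hk
    rw [mem_kerIn, hF.ext_conj_eq hx h (kerIn_le θ hk) A.one_mem
      (((mem_kerIn θ).1 hk).trans (ext_one θ).symm), mul_one, inv_mul_cancel, ext_one]
  rw [Subgroup.mem_normalizer_iff]
  refine fun k => ⟨fun hk => ?_, fun hk => ?_⟩
  · simpa using key x⁻¹ (inv_mem hx) (conj_inv_eq h) k hk
  · simpa [mul_assoc] using key x hx h _ hk

/-- Elements of the subgroup algebra on which the character does not vanish are invertible
modulo the annihilator of `F`. -/
theorem exists_mul_eq [Finite G] {a : MonoidAlgebra ℚ G} (ha : a ∈ subAlg A)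
    (h0 : linExt (ext θ) a ≠ 0) : ∃ w ∈ subAlg A, w * a * F = F := by
  let φ : subAlg A →ₐ[ℚ] ℂ := AlgHom.ofLinearMap (linExt (ext θ) ∘ₗ (subAlg A).val.toLinearMap)
    (linExt_one θ) fun u v => linExt_mul θ u.2 v
  have : Module.Finite ℚ (MonoidAlgebra ℚ G) :=
    Module.Finite.equiv (MonoidAlgebra.coeffLinearEquiv ℚ).symm
  have hfin : Module.Finite ℚ (subAlg A) :=
    inferInstanceAs (Module.Finite ℚ (Subalgebra.toSubmodule (subAlg A)))
  have hint : IsAlgebraic ℚ (φ ⟨a, ha⟩) :=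
    ((IsIntegral.of_finite ℚ (⟨a, ha⟩ : subAlg A)).map φ).isAlgebraic
  -- The image of `ℚA` in `ℂ` is a finite-dimensional `ℚ`-algebra, so it contains the inverses of
  -- its elements.
  obtain ⟨w, hw⟩ := Subalgebra.inv_mem_of_algebraic φ.range
    (x := ⟨φ ⟨a, ha⟩, AlgHom.mem_range_self φ _⟩) hint
  have hw : linExt (ext θ) w = (linExt (ext θ) a)⁻¹ := hw
  exact ⟨w, w.2, hF.mul_eq (mul_mem w.2 ha)
    (by rw [linExt_mul θ w.2, hw, inv_mul_cancel₀ h0])⟩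

end IsCharIdem

/-- The conjugate of a linear character of `A` by an element of the normalizer of `A`. -/
def conjChar {A : Subgroup G} (θ : A →* ℂˣ) {x : G} (hx : x ∈ Subgroup.normalizer (A : Set G)) :
    A →* ℂˣ where
  toFun a := θ ⟨x * a * x⁻¹, mul_mul_inv_mem hx a.2⟩
  map_one' := by
    rw [← map_one θ]
    congr 1
    ext
    simp
  map_mul' a b := by
    rw [← map_mul]
    congr 1
    ext
    simp [mul_assoc]

theorem ext_conjChar {A : Subgroup G} (θ : A →* ℂˣ) {x : G}
    (hx : x ∈ Subgroup.normalizer (A : Set G)) (g : G) :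
    ext (conjChar θ hx) g = ext θ (x * g * x⁻¹) := by
  by_cases hg : g ∈ A
  · rw [ext_of_mem _ hg, ext_of_mem _ (mul_mul_inv_mem hx hg)]
    rfl
  · rw [ext_of_notMem _ hg, ext_of_notMem]
    rwa [← Subgroup.mem_normalizer_iff.1 hx g]

/-- The conjugate character has the same kernel, and `ε` depends on the domain and the kernel alone;
so the same `ε` is the idempotent of both characters. -/
theorem conj_eps_eq [Finite G] {A : Subgroup G} (θ : A →* ℂˣ) {x : G}
    (hx : x ∈ Subgroup.normalizer (A : Set G))
    (hk : x ∈ Subgroup.normalizer (kerIn θ : Set G)) :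
    conj (eps A (kerIn θ)) x = eps A (kerIn θ) := by
  have hker : kerIn (conjChar θ hx) = kerIn θ := by
    ext g
    rw [mem_kerIn, ext_conjChar, ← mem_kerIn, ← Subgroup.mem_normalizer_iff.1 hk g]
  have h := (isCharIdem_eps (conjChar θ hx)).linExt_eq
  rw [hker] at h
  have hfun : ext (conjChar θ hx) = fun g => ext θ ((x⁻¹)⁻¹ * g * x⁻¹) := by
    funext g
    rw [ext_conjChar, inv_inv]
  rw [hfun, ← linExt_conj] at h
  simpa using IsCharIdem.conj_inv_eq ((isCharIdem_eps θ).conj_eq_of_linExt (inv_mem hx) h)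

/-! ## Sums of distinct conjugates -/

theorem conj_eq_conj_iff {a : MonoidAlgebra ℚ G} {x y : G} :
    conj a x = conj a y ↔ conj a (x * y⁻¹) = a := by
  rw [← conj_conj]
  constructor
  · intro h
    rw [h, conj_conj_inv]
  · intro h
    nth_rewrite 2 [← h]
    rw [conj_inv_conj]

theorem conj_mul_conj {X : Subgroup G} {f : MonoidAlgebra ℚ G}
    (horth : ∀ x ∈ X, conj f x = f ∨ f * conj f x = 0)
    {x y : G} (hx : x ∈ X) (hy : y ∈ X) (h : conj f x ≠ conj f y) :
    conj f x * conj f y = 0 := by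
  have h1 : conj f y = conj (conj f (y * x⁻¹)) x := by
    rw [conj_conj, inv_mul_cancel_right]
  rw [h1, ← conj_mul]
  rcases horth _ (mul_mem hy (inv_mem hx)) with h2 | h2
  · exact absurd (by rw [h1, h2]) h
  · rw [h2, conj_zero]

section orbSum

variable [Finite G]

/-- The sum of the distinct `X`-conjugates of `a`. -/
def orbSum (X : Subgroup G) (a : MonoidAlgebra ℚ G) : MonoidAlgebra ℚ G :=
  ∑ b ∈ (Set.finite_range fun x : X => conj a (x : G)).toFinset, b

theorem e_eq_orbSum (X H K : Subgroup G) : e X H K = orbSum X (eps H K) := rfl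

theorem mem_conjugates {X : Subgroup G} {a b : MonoidAlgebra ℚ G} :
    b ∈ (Set.finite_range fun x : X => conj a (x : G)).toFinset ↔ ∃ x ∈ X, conj a x = b := by
  simp

open Classical in
-- Each distinct conjugate occurs once for every element of a coset of the centralizer. Sums over
-- all of `X` are easy to reindex, so facts on `orbSum` are proved through them.
theorem sum_conj_eq (X : Subgroup G) (a : MonoidAlgebra ℚ G) :
    ∑ x ∈ elems X, conj a x = (Nat.card (cen X a) : ℚ) • orbSum X a := by
  have himg : (elems X).image (conj a) =
      (Set.finite_range fun x : X => conj a (x : G)).toFinset := by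
    ext b
    simp only [Finset.mem_image, mem_elems, mem_conjugates]
  rw [orbSum, Finset.sum_comp (fun b => b) (conj a), himg, Finset.smul_sum]
  refine Finset.sum_congr rfl fun b hb => ?_
  obtain ⟨y, hy, rfl⟩ := mem_conjugates.1 hb
  rw [← Nat.cast_smul_eq_nsmul ℚ, ← card_elems]
  congr 2
  refine Finset.card_bij' (fun x _ => x * y⁻¹) (fun x _ => x * y) ?_ ?_ ?_ ?_
  · intro x hx
    rw [Finset.mem_filter, mem_elems] at hx
    exact mem_elems.2 (mem_cen.2 ⟨mul_mem hx.1 (inv_mem hy), conj_eq_conj_iff.1 hx.2⟩)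
  · intro x hx
    have hx := mem_cen.1 (mem_elems.1 hx)
    rw [Finset.mem_filter, mem_elems, conj_eq_conj_iff, mul_inv_cancel_right]
    exact ⟨mul_mem hx.1 hy, hx.2⟩
  · exact fun x _ => inv_mul_cancel_right x y
  · exact fun x _ => mul_inv_cancel_right x y

theorem sum_conj_conj (X : Subgroup G) (a : MonoidAlgebra ℚ G) {y : G} (hy : y ∈ X) :
    ∑ x ∈ elems X, conj a (x * y) = ∑ x ∈ elems X, conj a x := by
  refine Finset.sum_bij' (fun x _ => x * y) (fun x _ => x * y⁻¹) ?_ ?_ ?_ ?_ ?_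
  · exact fun g hg => mem_elems.2 (mul_mem (mem_elems.1 hg) hy)
  · exact fun g hg => mem_elems.2 (mul_mem (mem_elems.1 hg) (inv_mem hy))
  · exact fun g _ => mul_inv_cancel_right g y
  · exact fun g _ => inv_mul_cancel_right g y
  · exact fun g _ => rfl

theorem sum_conj_conj' (X : Subgroup G) (a : MonoidAlgebra ℚ G) {y : G} (hy : y ∈ X) :
    ∑ x ∈ elems X, conj (conj a y) x = ∑ x ∈ elems X, conj a x := by
  simp only [conj_conj]
  refine Finset.sum_bij' (fun x _ => y * x) (fun x _ => y⁻¹ * x) ?_ ?_ ?_ ?_ ?_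
  · exact fun g hg => mem_elems.2 (mul_mem hy (mem_elems.1 hg))
  · exact fun g hg => mem_elems.2 (mul_mem (inv_mem hy) (mem_elems.1 hg))
  · exact fun g _ => inv_mul_cancel_left y g
  · exact fun g _ => mul_inv_cancel_left y g
  · exact fun g _ => rfl

theorem conj_orbSum (X : Subgroup G) (a : MonoidAlgebra ℚ G) {y : G} (hy : y ∈ X) :
    conj (orbSum X a) y = orbSum X a := by
  have h : conj (∑ x ∈ elems X, conj a x) y = ∑ x ∈ elems X, conj a x := by
    rw [conj_sum]
    simp only [conj_conj]
    exact sum_conj_conj X a hy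
  rw [sum_conj_eq, conj_smul] at h
  exact smul_right_injective _ (card_subgroup_ne_zero (cen X a)) h

theorem orbSum_mem_subAlg {X Y : Subgroup G} {a : MonoidAlgebra ℚ G} (hX : X ≤ Y)
    (ha : a ∈ subAlg Y) : orbSum X a ∈ subAlg Y := by
  refine Subalgebra.sum_mem _ fun b hb => ?_
  obtain ⟨x, hx, rfl⟩ := mem_conjugates.1 hb
  exact conj_mem_subAlg (fun g hg => mul_mem (mul_mem (inv_mem (hX hx)) hg) (hX hx)) ha

theorem orbSum_eq_self {X : Subgroup G} {a : MonoidAlgebra ℚ G}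
    (h : ∀ x ∈ X, conj a x = a) : orbSum X a = a := by
  have : (Set.finite_range fun x : X => conj a (x : G)).toFinset = {a} := by
    ext b
    rw [mem_conjugates, Finset.mem_singleton]
    constructor
    · rintro ⟨x, hx, rfl⟩
      exact h x hx
    · rintro rfl
      exact ⟨1, X.one_mem, conj_one b⟩
  rw [orbSum, this, Finset.sum_singleton]

/-- Summing conjugates in stages. -/
theorem orbSum_tower {L M : Subgroup G} (hLM : L ≤ M) {a f : MonoidAlgebra ℚ G} {m : ℚ}
    (h : orbSum L a = m • f) :
    (Nat.card (cen M a) : ℚ) • orbSum M a =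
      ((Nat.card L : ℚ)⁻¹ * Nat.card (cen L a) * m * Nat.card (cen M f)) • orbSum M f := by
  -- Replacing `a` by an `L`-conjugate does not change the full sum over `M`; adding this up over
  -- `L` and exchanging the sums brings in the `L`-orbit sum.
  have h1 : (Nat.card L : ℚ) • ∑ x ∈ elems M, conj a x =
      ∑ y ∈ elems L, ∑ x ∈ elems M, conj (conj a y) x := by
    rw [Finset.sum_congr rfl fun y hy => sum_conj_conj' M a (hLM (mem_elems.1 hy)),
      Finset.sum_const, card_elems, Nat.cast_smul_eq_nsmul]
  rw [Finset.sum_comm] at h1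
  simp only [← conj_sum] at h1
  rw [sum_conj_eq L, h, smul_smul] at h1
  simp only [conj_smul] at h1
  rw [← Finset.smul_sum, sum_conj_eq, sum_conj_eq] at h1
  have h2 := congrArg (fun z => (Nat.card L : ℚ)⁻¹ • z) h1
  rw [smul_smul, inv_mul_cancel₀ (card_subgroup_ne_zero L), one_smul, smul_smul, smul_smul] at h2
  rw [h2]
  congr 1
  ring

variable {X : Subgroup G} {f : MonoidAlgebra ℚ G} (hf : f * f = f)
  (horth : ∀ x ∈ X, conj f x = f ∨ f * conj f x = 0)

include hf horth

theorem orbSum_mul_self : orbSum X f * f = f := by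
  rw [orbSum, Finset.sum_mul, Finset.sum_eq_single f]
  · exact hf
  · intro b hb hbf
    obtain ⟨x, hx, rfl⟩ := mem_conjugates.1 hb
    have := conj_mul_conj horth hx X.one_mem
    rw [conj_one] at this
    exact this hbf
  · exact fun h => absurd (mem_conjugates.2 ⟨1, X.one_mem, conj_one f⟩) h

theorem orbSum_idem : orbSum X f * orbSum X f = orbSum X f := by
  conv_lhs => rw [orbSum.eq_1 X f, ← orbSum.eq_1 X f, orbSum.eq_1 X f]
  rw [Finset.mul_sum]
  refine Finset.sum_congr rfl fun b hb => ?_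
  -- The orbit sum is invariant under `x`, so its product with the conjugate of `f` is the conjugate
  -- of its product with `f`.
  obtain ⟨x, hx, rfl⟩ := mem_conjugates.1 hb
  rw [← orbSum.eq_1]
  nth_rewrite 1 [← conj_orbSum X f hx]
  rw [← conj_mul, orbSum_mul_self hf horth]

end orbSum

/-! ## Primitive central idempotents of subgroup algebras -/

/-- `f` is a primitive central idempotent of the rational group algebra of `X`. -/
structure IsPrimCentral (X : Subgroup G) (f : MonoidAlgebra ℚ G) : Prop where
  mem : f ∈ subAlg X
  comm : ∀ x ∈ X, Commute (MonoidAlgebra.of ℚ G x) f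
  idem : f * f = f
  ne_zero : f ≠ 0
  prim : ∀ b ∈ subAlg X, (∀ x ∈ X, Commute (MonoidAlgebra.of ℚ G x) b) → b * b = b →
    b * f = b → b = 0 ∨ b = f

theorem IsPrimCentral.commute {X : Subgroup G} {f : MonoidAlgebra ℚ G} (hf : IsPrimCentral X f)
    {a : MonoidAlgebra ℚ G} (ha : a ∈ subAlg X) : Commute a f :=
  commute_subAlg ha hf.comm

theorem IsCharIdem.isPrimCentral {A : Subgroup G} {θ : A →* ℂˣ} {F : MonoidAlgebra ℚ G}
    (hF : IsCharIdem θ F) : IsPrimCentral A F := by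
  refine ⟨hF.mem, hF.comm, hF.idem, hF.ne_zero, fun b hb _ hbb hbF => ?_⟩
  have h1 := linExt_mul θ hb b
  rw [hbb] at h1
  rcases eq_or_ne (linExt (ext θ) b) 0 with h0 | h0
  · exact Or.inl (hbF ▸ hF.mul_eq_zero b hb h0)
  · exact Or.inr (hbF ▸ hF.mul_eq hb (mul_left_cancel₀ h0 (by rw [← h1, mul_one])))

theorem subAlg_top : subAlg (⊤ : Subgroup G) = ⊤ :=
  top_unique fun _ _ => mem_subAlg_of_coeff fun x hx => absurd (Subgroup.mem_top x) hx

theorem IsPrimCentral.isPrimitiveCentralIdempotent {f : MonoidAlgebra ℚ G}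
    (hf : IsPrimCentral ⊤ f) : IsPrimitiveCentralIdempotent f := by
  have hmem : ∀ a : MonoidAlgebra ℚ G, a ∈ subAlg (⊤ : Subgroup G) := fun a => by
    rw [subAlg_top]; exact Algebra.mem_top
  refine ⟨hf.ne_zero, hf.idem, ?_, fun b c hb hc hbz _ hbc hf' => ?_⟩
  · rw [Semigroup.mem_center_iff]
    exact fun a => hf.commute (hmem a)
  · have hbf : b * f = b := by rw [hf', mul_add, hb.eq, hbc, add_zero]
    refine (hf.prim b (hmem b) (fun x _ => Semigroup.mem_center_iff.1 hbz _) hb.eq hbf).imp_right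
      fun h => ?_
    rw [← h] at hf'
    simpa using hf'

/-! ## Clifford correspondence for primitive central idempotents -/

theorem mem_inertia_iff {M A : Subgroup G} (θ : A →* ℂˣ)
    (hM : M ≤ Subgroup.normalizer (A : Set G)) {x : G} (hx : x ∈ M) :
    x ∈ inertia M θ ↔ ∀ g ∈ A, ext θ (x * g * x⁻¹) = ext θ g := by
  refine ⟨fun h g _ => h.2 g, fun h => ⟨hx, fun g => ?_⟩⟩
  by_cases hg : g ∈ A
  · exact h g hg
  · rw [ext_of_notMem θ hg, ext_of_notMem]
    rwa [← Subgroup.mem_normalizer_iff.1 (hM hx) g]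

/-- `L` is the inertia group in `M` of the linear character `θ` of the normal subgroup `A` of `M`,
and `f` is a primitive central idempotent of the rational group algebra of `L` lying over the
idempotent `F` of `θ`. -/
structure IsCliffordPair (M L : Subgroup G) {A : Subgroup G} (θ : A →* ℂˣ)
    (F f : MonoidAlgebra ℚ G) : Prop where
  le : A ≤ L
  normal : M ≤ Subgroup.normalizer (A : Set G)
  inertia_eq : inertia M θ = L
  isCharIdem : IsCharIdem θ F
  isPrimCentral : IsPrimCentral L f
  mul_eq : F * f = f

namespace IsCliffordPair

variable {M L A : Subgroup G} {θ : A →* ℂˣ} {F f : MonoidAlgebra ℚ G}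
  (h : IsCliffordPair M L θ F f)

include h

theorem mem_iff {x : G} : x ∈ L ↔ x ∈ M ∧ ∀ g, ext θ (x * g * x⁻¹) = ext θ g := by
  rw [← h.inertia_eq]; rfl

theorem le' : L ≤ M := fun _ hx => (h.mem_iff.1 hx).1

theorem mem_iff_of_mem {x : G} (hx : x ∈ M) :
    x ∈ L ↔ ∀ g ∈ A, ext θ (x * g * x⁻¹) = ext θ g := by
  rw [← h.inertia_eq, mem_inertia_iff θ h.normal hx]

theorem conj_F_of_mem {x : G} (hx : x ∈ L) : conj F x = F :=
  h.isCharIdem.conj_eq_of_invariant (h.normal (h.le' hx)) (h.mem_iff.1 hx).2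

theorem F_mul_comm : f * F = f := by
  rw [← (h.isPrimCentral.commute (subAlg_mono h.le h.isCharIdem.mem)).eq, h.mul_eq]

/-- Galois conjugate characters have the same inertia group; `ext_conj_eq` supplies exactly what is
needed. -/
theorem mem_normalizer {x : G} (hx : x ∈ M) (hF : conj F x = F) :
    x ∈ Subgroup.normalizer (L : Set G) := by
  have key : ∀ x ∈ M, conj F x = F → ∀ l ∈ L, x⁻¹ * l * x ∈ L := by
    intro x hx hF l hl
    rw [h.mem_iff_of_mem (mul_mem (mul_mem (inv_mem hx) (h.le' hl)) hx)]
    intro a ha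
    have ha' : x * a * x⁻¹ ∈ A := mul_mul_inv_mem (h.normal hx) ha
    have := h.isCharIdem.ext_conj_eq (h.normal hx) hF
      (mul_mul_inv_mem (h.normal (h.le' hl)) ha') ha' ((h.mem_iff.1 hl).2 _)
    simpa [mul_assoc] using this
  rw [Subgroup.mem_normalizer_iff]
  refine fun l => ⟨fun hl => ?_, fun hl => ?_⟩
  · simpa using key x⁻¹ (inv_mem hx) (IsCharIdem.conj_inv_eq hF) l hl
  · simpa [mul_assoc] using key x hx hF _ hl

theorem conj_mem {x : G} (hx : x ∈ M) (hF : conj F x = F) : conj f x ∈ subAlg L :=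
  conj_mem_subAlg (fun _ hg => inv_mul_mul_mem (h.mem_normalizer hx hF) hg) h.isPrimCentral.mem

theorem commute_conj {x : G} (hx : x ∈ M) (hF : conj F x = F) :
    ∀ l ∈ L, Commute (MonoidAlgebra.of ℚ G l) (conj f x) := by
  intro l hl
  have h1 := h.isPrimCentral.comm _ (mul_mul_inv_mem (h.mem_normalizer hx hF) hl)
  rw [← conj_eq_self_iff, conj_conj]
  rw [← conj_eq_self_iff] at h1
  nth_rewrite 2 [← h1]
  rw [conj_conj]
  congr 1
  group

/-- As `x` normalizes `L`, the product is a central idempotent of `ℚL` below the primitive `f`. -/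
theorem mul_conj_eq_or {x : G} (hx : x ∈ M) (hF : conj F x = F) :
    f * conj f x = 0 ∨ f * conj f x = f := by
  have hf := h.isPrimCentral
  have hmem := h.conj_mem hx hF
  have hc := hf.commute hmem
  refine hf.prim _ (mul_mem hf.mem hmem) (fun l hl => (hf.comm l hl).mul_right
    (h.commute_conj hx hF l hl)) ?_ ?_
  · calc f * conj f x * (f * conj f x) = f * (conj f x * f) * conj f x := by simp only [mul_assoc]
      _ = (f * f) * (conj f x * conj f x) := by rw [hc.eq]; simp only [mul_assoc]
      _ = _ := by rw [← conj_mul, hf.idem]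
  · rw [mul_assoc, hc.eq, ← mul_assoc, hf.idem]

theorem conj_eq_or {x : G} (hx : x ∈ M) : conj f x = f ∨ f * conj f x = 0 := by
  have hf := h.isPrimCentral
  rcases h.isCharIdem.conj_eq_or (h.normal hx) with hF | hF
  · have hc := hf.commute (h.conj_mem hx hF)
    have key : ∀ b, f * conj f x⁻¹ = b → conj f x * f = conj b x := fun b hb => by
      rw [← hb, conj_mul, conj_inv_conj]
    rcases h.mul_conj_eq_or hx hF with h1 | h1
    · exact Or.inr h1
    rcases h.mul_conj_eq_or (inv_mem hx) (IsCharIdem.conj_inv_eq hF) with h2 | h2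
    · right
      rw [← hc.eq, key _ h2, conj_zero]
    · left
      rw [← key _ h2, hc.eq, h1]
  · right
    have h1 : F * conj F x = 0 := by
      rw [← (h.isCharIdem.commute (h.isCharIdem.conj_mem (h.normal hx))).eq, hF]
    calc f * conj f x = f * F * conj (F * f) x := by rw [h.F_mul_comm, h.mul_eq]
      _ = f * (F * conj F x) * conj f x := by rw [conj_mul]; simp only [mul_assoc]
      _ = 0 := by rw [h1, mul_zero, zero_mul]

theorem conj_F_eq {x : G} (hx : x ∈ M) (hfx : conj f x = f) : conj F x = F := by
  refine (h.isCharIdem.conj_eq_or (h.normal hx)).resolve_right fun h0 =>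
    h.isPrimCentral.ne_zero ?_
  have h1 : conj F x * f = f := by
    nth_rewrite 1 [← hfx]
    rw [← conj_mul, h.mul_eq, hfx]
  rw [← h1, ← h.mul_eq, ← mul_assoc, h0, zero_mul]

/-- This is where the inertia group enters: an `x` outside `L` moves `θ`, and this forces the part
of `f b` on the coset `L x` to vanish. -/
theorem mul_mem_subAlg [Finite G] {b : MonoidAlgebra ℚ G} (hb : b ∈ subAlg M)
    (hbc : ∀ x ∈ M, Commute (MonoidAlgebra.of ℚ G x) b) : f * b ∈ subAlg L := by
  have hf := h.isPrimCentral
  have hF := h.isCharIdem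
  refine mem_subAlg_of_proj (mul_mem (subAlg_mono h.le' hf.mem) hb) fun x hx hxL => ?_
  set y := proj L (f * b * MonoidAlgebra.of ℚ G x⁻¹)
  have hy : y ∈ subAlg L := proj_mem_subAlg _ _
  have hfy : f * y = y := by
    rw [← proj_mul hf.mem, ← mul_assoc, ← mul_assoc, hf.idem]
  have hyf : y * f = y := by rw [(hf.commute hy).eq, hfy]
  have hFy : F * y = y := by rw [← hfy, ← mul_assoc, h.mul_eq]
  rw [h.mem_iff_of_mem hx] at hxL
  push Not at hxL
  obtain ⟨a, ha, hne⟩ := hxL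
  have ha' : x * a * x⁻¹ ∈ A := mul_mul_inv_mem (h.normal hx) ha
  set u := MonoidAlgebra.of ℚ G a
  set u' := MonoidAlgebra.of ℚ G (x * a * x⁻¹)
  -- Both `f` and `b` commute with `a`; moving `a` past `x⁻¹` turns it into its conjugate.
  have huy : u * y = y * u' := by
    rw [← proj_of_mul (h.le ha), ← proj_mul_of (h.le ha')]
    congr 1
    calc u * (f * b * MonoidAlgebra.of ℚ G x⁻¹) = (u * f) * b * MonoidAlgebra.of ℚ G x⁻¹ := by
          simp only [mul_assoc]
      _ = f * (u * b) * MonoidAlgebra.of ℚ G x⁻¹ := by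
          rw [show u * f = f * u from (hf.comm a (h.le ha)).eq]; simp only [mul_assoc]
      _ = f * b * (u * MonoidAlgebra.of ℚ G x⁻¹) := by
          rw [show u * b = b * u from hbc a (h.le' (h.le ha))]; simp only [mul_assoc]
      _ = _ := by
          rw [mul_assoc (f * b), ← map_mul, ← map_mul]
          congr 2
          group
  -- Elements of `L` fix `θ`, so conjugating `u'` by them is invisible after multiplication by `F`.
  -- Thus `u' F` commutes with `ℚL`, and `y` absorbs `F`.
  have hcomm : y * u' = u' * y := by
    have h1 : ∀ l ∈ L, Commute (MonoidAlgebra.of ℚ G l) (u' * F) := by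
      intro l hl
      rw [← conj_eq_self_iff, conj_mul, h.conj_F_of_mem hl]
      have h2 := hF.mul_eq_zero
        (MonoidAlgebra.of ℚ G (l⁻¹ * (x * a * x⁻¹) * l) - u')
        (sub_mem (of_mem_subAlg (inv_mul_mul_mem (h.normal (h.le' hl)) ha')) (of_mem_subAlg ha'))
        (by
          rw [map_sub, linExt_of, linExt_of, ← (h.mem_iff.1 hl).2 (l⁻¹ * (x * a * x⁻¹) * l),
            sub_eq_zero]
          congr 1
          group)
      rw [sub_mul, sub_eq_zero] at h2
      rw [conj_of, h2]
    have h3 := (commute_subAlg hy h1).eq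
    have h4 : y * F = y := by rw [← hyf, mul_assoc, h.F_mul_comm]
    have h5 := (hF.comm _ ha').eq
    calc y * u' = y * (u' * F) := by rw [h5, ← mul_assoc, h4]
      _ = u' * y := by rw [h3, mul_assoc, hFy]
  have hz : (u - u') * y = 0 := by rw [sub_mul, huy, hcomm, sub_self]
  -- The character separates `a` from its conjugate, so `u - u'` is invertible modulo the
  -- annihilator of `F`; hence `y = 0`.
  obtain ⟨w, -, hw⟩ := hF.exists_mul_eq (sub_mem (of_mem_subAlg ha) (of_mem_subAlg ha'))
    (by rw [map_sub, linExt_of, linExt_of]; exact sub_ne_zero.2 (Ne.symm hne))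
  rw [← hFy, ← hw, mul_assoc, hFy, mul_assoc, hz, mul_zero]

theorem orbSum_mul_self [Finite G] : orbSum M f * f = f :=
  CliffordTree.orbSum_mul_self h.isPrimCentral.idem fun _ hx => h.conj_eq_or hx

/-- The Clifford correspondent in `M` of a primitive central idempotent. -/
theorem isPrimCentral_orbSum [Finite G] : IsPrimCentral M (orbSum M f) := by
  have hf := h.isPrimCentral
  refine ⟨orbSum_mem_subAlg le_rfl (subAlg_mono h.le' hf.mem),
    fun x hx => conj_eq_self_iff.1 (conj_orbSum M f hx),
    orbSum_idem hf.idem fun _ hx => h.conj_eq_or hx, fun h0 => hf.ne_zero ?_, ?_⟩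
  · rw [← h.orbSum_mul_self, h0, zero_mul]
  intro b hb hbc hbb hbf
  have hcf : Commute b f := (commute_subAlg (subAlg_mono h.le' hf.mem) hbc).symm
  have hbx : ∀ x ∈ M, b * conj f x = conj (b * f) x := fun x hx => by
    rw [conj_mul, conj_eq_self_iff.2 (hbc x hx)]
  -- Primitivity in `ℚM` descends to `L`: `f b` is a central idempotent of `ℚL` below `f`, and
  -- whichever of 0 and `f` it is, conjugation carries the alternative to all conjugates of `f`.
  have hprim := hf.prim (f * b) (h.mul_mem_subAlg hb hbc)
    (fun x hx => (hf.comm x hx).mul_right (hbc x (h.le' hx)))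
    (by rw [mul_assoc, ← mul_assoc b, hcf.eq, ← mul_assoc, ← mul_assoc, hf.idem, mul_assoc, hbb])
    (by rw [mul_assoc, hcf.eq, ← mul_assoc, hf.idem])
  rw [← hcf.eq] at hprim
  rcases hprim with h0 | h0
  · left
    rw [← hbf, orbSum, Finset.mul_sum]
    refine Finset.sum_eq_zero fun d hd => ?_
    obtain ⟨x, hx, rfl⟩ := mem_conjugates.1 hd
    rw [hbx x hx, h0, conj_zero]
  · right
    rw [← hbf, orbSum, Finset.mul_sum]
    refine Finset.sum_congr rfl fun d hd => ?_
    obtain ⟨x, hx, rfl⟩ := mem_conjugates.1 hd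
    rw [hbx x hx, h0]

end IsCliffordPair

section

/-! ## Centralizers of Clifford correspondents -/

theorem cen_smul {X : Subgroup G} {a : MonoidAlgebra ℚ G} {r : ℚ} (hr : r ≠ 0) :
    cen X (r • a) = cen X a := by
  ext x
  rw [mem_cen, mem_cen, conj_smul, (smul_right_injective _ hr).eq_iff]

namespace IsCliffordPair

variable {M L A : Subgroup G} {θ : A →* ℂˣ} {F f : MonoidAlgebra ℚ G}

theorem le_cen (h : IsCliffordPair M L θ F f) : L ≤ cen M f := fun x hx =>
  mem_cen.2 ⟨h.le' hx, conj_eq_self_iff.2 (h.isPrimCentral.comm x hx)⟩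

/-- If `x` fixes `E` but moves `f`, then `f` and its conjugate are orthogonal although both fix `E`
by multiplication. -/
theorem cen_le_cen (h : IsCliffordPair M L θ F f) {E : MonoidAlgebra ℚ G} (hE : E ≠ 0)
    (hfE : f * E = E) : cen M E ≤ cen M f := by
  intro x hx
  rw [mem_cen] at hx ⊢
  refine ⟨hx.1, (h.conj_eq_or hx.1).resolve_right fun h0 => hE ?_⟩
  have h1 : conj f x * E = E := by
    nth_rewrite 1 [← hx.2]
    rw [← conj_mul, hfE, hx.2]
  rw [← hfE, ← h1, ← mul_assoc, h0, zero_mul]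

theorem cen_le_normIn (h : IsCliffordPair M L θ F f) : cen M f ≤ normIn M (kerIn θ) := by
  intro x hx
  rw [mem_cen] at hx
  exact ⟨hx.1, h.isCharIdem.mem_normalizer_kerIn (h.normal hx.1) (h.conj_F_eq hx.1 hx.2)⟩

end IsCliffordPair

/-! ### Galois conjugates of induced characters -/

theorem linExt_conj_of_galois {L : Subgroup G} {x : G} {φ : G → ℂ} {σ : ℂ ≃+* ℂ}
    (hσ : ∀ g ∈ L, φ (x * g * x⁻¹) = σ (φ g)) {b : MonoidAlgebra ℚ G} (hb : b ∈ subAlg L) :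
    linExt φ (conj b x⁻¹) = σ (linExt φ b) := by
  -- The automorphism is only `ℚ`-linear, which suffices for rational coefficients; `proj L`
  -- confines the comparison to the elements where the hypothesis applies.
  have h1 : linExt φ ∘ₗ (conjHom x⁻¹).toLinearMap ∘ₗ proj L =
      (σ.toRingHom.toAddMonoidHom.toRatLinearMap) ∘ₗ linExt φ ∘ₗ proj L := by
    refine linMap_ext fun g => ?_
    by_cases hg : g ∈ L
    · simp only [LinearMap.comp_apply, proj_of_mem hg, AlgHom.toLinearMap_apply, conjHom_apply,
        conj_of, linExt_of, inv_inv]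
      exact hσ g hg
    · simp only [LinearMap.comp_apply, proj_of_notMem hg, map_zero]
  have h2 := LinearMap.congr_fun h1 b
  simp only [LinearMap.comp_apply, proj_eq_self hb] at h2
  exact h2

section ind

variable [Finite G]

/-- All summands of the induced character agree on an element that commutes with `L`. -/
theorem linExt_ind {A : Subgroup G} (θ : A →* ℂˣ) {L : Subgroup G} {b : MonoidAlgebra ℚ G}
    (hb : ∀ l ∈ L, Commute (MonoidAlgebra.of ℚ G l) b) :
    linExt (ind L θ) b = (Nat.card A : ℂ)⁻¹ * (Nat.card L * linExt (ext θ) b) := by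
  have h1 : linExt (ind L θ) = (Nat.card A : ℂ)⁻¹ •
      ∑ x ∈ elems L, linExt (fun g => ext θ (x * g * x⁻¹)) := by
    refine linMap_ext fun g => ?_
    simp only [LinearMap.smul_apply, LinearMap.sum_apply, linExt_of, smul_eq_mul, ind]
  rw [h1, LinearMap.smul_apply, LinearMap.sum_apply, smul_eq_mul, ← card_elems L,
    ← nsmul_eq_mul]
  congr 1
  rw [← Finset.sum_const]
  refine Finset.sum_congr rfl fun x hx => ?_
  have h2 := linExt_conj (ext θ) x⁻¹ b
  rw [conj_eq_self_iff.2 (hb _ (inv_mem (mem_elems.1 hx))), inv_inv] at h2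
  exact h2.symm

theorem IsCliffordPair.normIn_le_cen {M L A : Subgroup G} {θ : A →* ℂˣ} {f : MonoidAlgebra ℚ G}
    (h : IsCliffordPair M L θ (eps A (kerIn θ)) f) {H : Subgroup G} {χ : H →* ℂˣ} (hHL : H ≤ L)
    {E : MonoidAlgebra ℚ G} (hE : IsCharIdem χ E) (hfE : f * E = E)
    (hgood : ∀ x ∈ normIn M (kerIn θ), ∃ σ : ℂ ≃+* ℂ, ∀ g ∈ L,
      ind L χ (x * g * x⁻¹) = σ (ind L χ g)) : normIn M (kerIn θ) ≤ cen M f := by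
  intro x hx
  have hxM : x ∈ M := hx.1
  obtain ⟨σ, hσ⟩ := hgood x hx
  have hF := conj_eps_eq θ (h.normal hxM) hx.2
  refine mem_cen.2 ⟨hxM, (h.conj_eq_or hxM).resolve_right fun h0 => ?_⟩
  have hEf : E * f = E := by
    rw [(h.isPrimCentral.commute (subAlg_mono hHL hE.mem)).eq, hfE]
  have hlin : ∀ b, linExt (ext χ) (E * b) = linExt (ext χ) b := fun b => by
    rw [linExt_mul χ hE.mem, hE.linExt_eq, one_mul]
  have h1 : linExt (ext χ) f = 1 := by rw [← hlin, hEf, hE.linExt_eq]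
  have h2 : linExt (ext χ) (conj f x) = 0 := by
    rw [← hlin, ← hEf, mul_assoc, h0, mul_zero, map_zero]
  -- Evaluated at the conjugate of `f`, the Galois relation equates the value of the induced
  -- character at `f`, a positive number, with the image of its value at the conjugate, which is 0.
  have h3 := linExt_conj_of_galois hσ (h.conj_mem hxM hF)
  rw [conj_conj_inv, linExt_ind χ h.isPrimCentral.comm, linExt_ind χ (h.commute_conj hxM hF), h1,
    h2, mul_zero, mul_zero, map_zero, mul_one] at h3
  exact mul_ne_zero (inv_ne_zero (Nat.cast_ne_zero.2 Nat.card_pos.ne'))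
    (Nat.cast_ne_zero.2 Nat.card_pos.ne') h3

end ind

/-! ## Products of subgroups -/

/-- The product set is a union of left cosets of `L`, and these form one orbit of `C` with
stabilizer `C ⊓ L`. The product need not be a subgroup. -/
theorem card_mul_coe (C L : Subgroup G) :
    Nat.card ((C : Set G) * (L : Set G) : Set G) = Nat.card L * L.relIndex C := by
  rw [Subgroup.card_mul_eq_card_subgroup_mul_card_quotient]
  congr 1
  have h1 : MulAction.stabilizer C ((1 : G) : G ⧸ L) = L.subgroupOf C := by
    ext c
    rw [MulAction.mem_stabilizer_iff, Subgroup.mem_subgroupOf]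
    change ((c * 1 : G) : G ⧸ L) = _ ↔ _
    rw [eq_comm, QuotientGroup.eq, inv_one, one_mul, mul_one]
  have h2 : ((C : Set G).image (QuotientGroup.mk : G → G ⧸ L)) =
      MulAction.orbit C ((1 : G) : G ⧸ L) := by
    ext q
    constructor
    · rintro ⟨c, hc, rfl⟩
      refine ⟨⟨c, hc⟩, ?_⟩
      change ((c * 1 : G) : G ⧸ L) = _
      rw [mul_one]
    · rintro ⟨c, rfl⟩
      refine ⟨c, c.2, ?_⟩
      change _ = ((c * 1 : G) : G ⧸ L)
      rw [mul_one]
  rw [h2, Nat.card_coe_set_eq, ← MulAction.index_stabilizer, h1, Subgroup.relIndex]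

theorem relIndex_mul_card_of_le {L T : Subgroup G} (h : L ≤ T) :
    L.relIndex T * Nat.card L = Nat.card T := by
  have := Subgroup.relIndex_mul_relIndex ⊥ L T bot_le h
  rw [Subgroup.relIndex_bot_left, Subgroup.relIndex_bot_left] at this
  rw [← this, mul_comm]

theorem mul_coe_subset {C L T : Subgroup G} (hC : C ≤ T) (hL : L ≤ T) :
    (C : Set G) * (L : Set G) ⊆ T := by
  rintro _ ⟨c, hc, l, hl, rfl⟩
  exact mul_mem (hC hc) (hL hl)

theorem card_mul_coe_le [Finite G] {C L T : Subgroup G} (hC : C ≤ T) (hL : L ≤ T) :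
    Nat.card ((C : Set G) * (L : Set G) : Set G) ≤ Nat.card T :=
  Nat.card_mono (Set.toFinite _) (mul_coe_subset hC hL)

theorem card_mul_coe_eq_iff [Finite G] {C L T : Subgroup G} (hC : C ≤ T) (hL : L ≤ T) :
    Nat.card T = Nat.card ((C : Set G) * (L : Set G) : Set G) ↔
      (T : Set G) = (C : Set G) * (L : Set G) := by
  constructor
  · intro h
    exact (Set.eq_of_subset_of_ncard_le (mul_coe_subset hC hL) h.le (Set.toFinite _)).symm
  · intro h
    rw [← h]
    rfl

/-! ## Paths in the tree -/

variable [Finite G]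

theorem edge_inertia_and_restriction {N : Subgroup G} {c : Choice N} {u w : Triple G} (h : Edge c u w) :
    w.H = inertia u.H w.θ ∧ w.A ≤ w.H ∧ u.H ≤ Subgroup.normalizer (w.A : Set G) ∧ u.A ≤ w.A ∧
      ∀ a ∈ u.A, ext w.θ a = ext u.θ a := by
  obtain ⟨hu, hw, -, φ, hφ, rfl⟩ := h
  have hext : ∀ a ∈ u.A, ext φ a = ext u.θ a := (c.rep_subset u hu hφ).1
  refine ⟨rfl, hw.1, (c.isAbelianOverKer u hu).2.2.1, fun a ha => ?_, hext⟩
  rw [← ext_ne_zero_iff φ, hext a ha, ext_ne_zero_iff]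
  exact ha

/-- `f` is a primitive central idempotent of the rational group algebra of the group of `t` lying
over the linear character of `t`. -/
def IsNodeIdem (t : Triple G) (f : MonoidAlgebra ℚ G) : Prop :=
  IsPrimCentral t.H f ∧ eps t.A (kerIn t.θ) * f = f

section path

variable {N : Subgroup G} {c : Choice N}

theorem Edge.isCliffordPair {u w : Triple G} (h : Edge c u w) {f : MonoidAlgebra ℚ G}
    (hf : IsNodeIdem w f) : IsCliffordPair u.H w.H w.θ (eps w.A (kerIn w.θ)) f := by
  obtain ⟨h1, h2, h3, -, -⟩ := edge_inertia_and_restriction h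
  exact ⟨h2, h3, h1.symm, isCharIdem_eps w.θ, hf.1, hf.2⟩

theorem Edge.isNodeIdem {u w : Triple G} (h : Edge c u w) {f : MonoidAlgebra ℚ G}
    (hf : IsNodeIdem w f) : IsNodeIdem u (orbSum u.H f) := by
  refine ⟨(h.isCliffordPair hf).isPrimCentral_orbSum, ?_⟩
  obtain ⟨-, -, -, hA, hext⟩ := edge_inertia_and_restriction h
  have hF := isCharIdem_eps u.θ
  have hFw := isCharIdem_eps w.θ
  have hmem := subAlg_mono hA hF.mem
  -- The character of `w` extends that of `u`, so it takes the value 1 on the idempotent of `u`,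
  -- which therefore acts as the identity on the idempotent of `w`.
  have h1 : linExt (ext w.θ) (eps u.A (kerIn u.θ)) = 1 := by
    have : linExt (ext w.θ) ∘ₗ proj u.A = linExt (ext u.θ) ∘ₗ proj u.A := by
      refine linMap_ext fun g => ?_
      by_cases hg : g ∈ u.A
      · simp only [LinearMap.comp_apply, proj_of_mem hg, linExt_of, hext g hg]
      · simp only [LinearMap.comp_apply, proj_of_notMem hg, map_zero]
    have h2 := LinearMap.congr_fun this (eps u.A (kerIn u.θ))
    simp only [LinearMap.comp_apply, proj_eq_self hF.mem] at h2
    rw [h2, hF.linExt_eq]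
  have h2 : eps u.A (kerIn u.θ) * f = f := by
    rw [← hf.2, ← mul_assoc, hFw.mul_eq hmem h1]
  rw [orbSum, Finset.mul_sum]
  refine Finset.sum_congr rfl fun b hb => ?_
  obtain ⟨x, hx, rfl⟩ := mem_conjugates.1 hb
  obtain ⟨-, hn, hinv, -⟩ := h.1
  nth_rewrite 1 [← hF.conj_eq_of_invariant (hn hx) (hinv x hx)]
  rw [← conj_mul, h2]

variable {v : ℕ → Triple G} {n : ℕ} (hedge : ∀ i, 1 ≤ i → i < n → Edge c (v i) (v (i + 1)))

include hedge

theorem path_H_le {i : ℕ} (hi : 1 ≤ i) (hin : i ≤ n) : (v n).H ≤ (v i).H := by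
  refine Nat.decreasingInduction' (P := fun i => (v n).H ≤ (v i).H) ?_ hin le_rfl
  intro k hkn hik ih
  refine ih.trans ?_
  rw [(edge_inertia_and_restriction (hedge k (hi.trans hik) hkn)).1]
  exact fun x hx => hx.1

theorem path_ext_eq {i : ℕ} (hi : 1 ≤ i) (hin : i ≤ n) :
    (v i).A ≤ (v n).A ∧ ∀ a ∈ (v i).A, ext (v n).θ a = ext (v i).θ a := by
  refine Nat.decreasingInduction' (P := fun i => (v i).A ≤ (v n).A ∧
    ∀ a ∈ (v i).A, ext (v n).θ a = ext (v i).θ a) ?_ hin ⟨le_rfl, fun _ _ => rfl⟩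
  intro k hkn hik ih
  obtain ⟨-, -, -, hA, hext⟩ := edge_inertia_and_restriction (hedge k (hi.trans hik) hkn)
  exact ⟨hA.trans ih.1, fun a ha => (ih.2 a (hA ha)).trans (hext a ha)⟩

theorem path_mem_of_commutator {i : ℕ} (hi : 1 ≤ i) (hin : i ≤ n) {g : G} (hg : g ∈ (v i).H)
    (h : ∀ a ∈ (v n).A, a⁻¹ * g⁻¹ * a * g ∈ (v n).A →
      a⁻¹ * g⁻¹ * a * g ∈ kerIn (v n).θ) : g ∈ (v n).H := by
  refine Nat.decreasingInduction' (P := fun i => g ∈ (v i).H → g ∈ (v n).H) ?_ hin id hg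
  intro k hkn hik ih hgk
  have he := hedge k (hi.trans hik) hkn
  obtain ⟨hH, -, hnorm, -, -⟩ := edge_inertia_and_restriction he
  obtain ⟨hA, hext⟩ := path_ext_eq hedge (i := k + 1) (by omega) (by omega)
  refine ih ?_
  rw [hH, mem_inertia_iff _ hnorm hgk]
  intro a ha
  have ha' : g * a * g⁻¹ ∈ (v (k + 1)).A := mul_mul_inv_mem (hnorm hgk) ha
  -- The hypothesis is applied to the conjugate of `a`, not to `a` itself: the resulting commutator
  -- compares precisely the two character values in the inertia condition.
  have heq : (g * a * g⁻¹)⁻¹ * g⁻¹ * (g * a * g⁻¹) * g = (g * a * g⁻¹)⁻¹ * a := by group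
  have h1 := h _ (hA ha') (by rw [heq]; exact mul_mem (inv_mem (hA ha')) (hA ha))
  rw [heq, mem_kerIn] at h1
  rw [← hext a ha, ← hext _ ha']
  have h2 := ext_mul_left (v n).θ (hA ha') ((g * a * g⁻¹)⁻¹ * a)
  rw [h1, mul_inv_cancel_left, mul_one] at h2
  exact h2.symm

variable {E : MonoidAlgebra ℚ G}

/-- The idempotents attached to the nodes, and the factor relating them to the sum of the
conjugates of `E`. -/
theorem exists_isNodeIdem (hE : IsNodeIdem (v n) E) {i : ℕ} (hi : 1 ≤ i) (hin : i ≤ n) :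
    ∃ f, IsNodeIdem (v i) f ∧ f * E = E ∧ ∃ μ : ℚ, 0 < μ ∧ orbSum (v i).H E = μ • f ∧
      Nat.card (cen (v i).H E) * μ = Nat.card (cen (v n).H E) *
        ∏ j ∈ Finset.Ioc i n,
          ((v j).H.relIndex (cen (v (j - 1)).H (orbSum (v j).H E)) : ℚ) ∧
      μ = ∏ j ∈ Finset.Ioc i n, ((Nat.card (cen (v (j - 1)).H (orbSum (v j).H E)) : ℚ) /
        Nat.card ((cen (v (j - 1)).H E : Set G) * ((v j).H : Set G) : Set G)) := by
  refine Nat.decreasingInduction' ?_ hin ?_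
  · rintro k hkn hik ⟨f, hf, hfE, μ, hμ, hsum, hμ1, hμ2⟩
    have he := hedge k (hi.trans hik) hkn
    have hpair := he.isCliffordPair hf
    set cK := cen (v k).H E with hcK
    set cL := cen (v (k + 1)).H E with hcL
    have hT : cen (v k).H (orbSum (v (k + 1)).H E) = cen (v k).H f := by
      rw [hsum, cen_smul hμ.ne']
    have hc0 : (Nat.card cK : ℚ) ≠ 0 := card_subgroup_ne_zero _
    have hL0 : (Nat.card (v (k + 1)).H : ℚ) ≠ 0 := card_subgroup_ne_zero _
    have hI : Finset.Ioc k n = insert (k + 1) (Finset.Ioc (k + 1) n) := by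
      ext j; simp only [Finset.mem_insert, Finset.mem_Ioc]; omega
    have hnot : k + 1 ∉ Finset.Ioc (k + 1) n := by simp
    -- The factor dictated by `orbSum_tower`. Using `cL = cK ⊓ (v (k + 1)).H`, it is `μ` times the
    -- order of `cen (v k).H f` over that of the product set of `cK` and `(v (k + 1)).H`.
    set ν : ℚ := (Nat.card cK : ℚ)⁻¹ *
      ((Nat.card (v (k + 1)).H : ℚ)⁻¹ * Nat.card cL * μ * Nat.card (cen (v k).H f)) with hν
    have htow := orbSum_tower hpair.le' hsum
    have hrel : ((v (k + 1)).H.relIndex (cen (v k).H f) : ℚ) * Nat.card (v (k + 1)).H =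
        Nat.card (cen (v k).H f) := by
      exact_mod_cast relIndex_mul_card_of_le hpair.le_cen
    have hinf : cL = cK ⊓ (v (k + 1)).H := by
      ext x
      rw [Subgroup.mem_inf, hcL, hcK, mem_cen, mem_cen]
      exact ⟨fun h => ⟨⟨hpair.le' h.1, h.2⟩, h.1⟩, fun h => ⟨h.2, h.1.2⟩⟩
    have hrel' : ((v (k + 1)).H.relIndex cK : ℚ) * Nat.card cL = Nat.card cK := by
      rw [← Subgroup.inf_relIndex_left, ← hinf]
      exact_mod_cast relIndex_mul_card_of_le (hinf ▸ inf_le_left : cL ≤ cK)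
    have hr0 : ((v (k + 1)).H.relIndex cK : ℚ) ≠ 0 := fun h0 => by
      rw [h0, zero_mul] at hrel'
      exact hc0 hrel'.symm
    refine ⟨orbSum (v k).H f, he.isNodeIdem hf, ?_, ν, ?_, ?_, ?_, ?_⟩
    · rw [← hfE, ← mul_assoc, hpair.orbSum_mul_self]
    · have h1 : (0 : ℚ) < Nat.card cK := Nat.cast_pos.2 Nat.card_pos
      have h2 : (0 : ℚ) < Nat.card (v (k + 1)).H := Nat.cast_pos.2 Nat.card_pos
      have h3 : (0 : ℚ) < Nat.card cL := Nat.cast_pos.2 Nat.card_pos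
      have h4 : (0 : ℚ) < Nat.card (cen (v k).H f) := Nat.cast_pos.2 Nat.card_pos
      positivity
    · refine smul_right_injective _ hc0 ?_
      simp only
      rw [htow, smul_smul, hν, mul_inv_cancel_left₀ hc0]
    · rw [hI, Finset.prod_insert hnot, add_tsub_cancel_right, hT,
        mul_left_comm (Nat.card (cen (v n).H E) : ℚ), ← hμ1, hν, mul_inv_cancel_left₀ hc0, ← hrel]
      field_simp
    · rw [hI, Finset.prod_insert hnot, add_tsub_cancel_right, hT, ← hμ2, card_mul_coe, ← hcK, hν,
        Nat.cast_mul, ← hrel']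
      have hcL0 : (Nat.card cL : ℚ) ≠ 0 := card_subgroup_ne_zero _
      field_simp
  · refine ⟨E, hE, hE.1.idem, 1, one_pos, ?_, ?_, ?_⟩
    · rw [one_smul, orbSum_eq_self fun x hx => conj_eq_self_iff.2 (hE.1.comm x hx)]
    · simp
    · simp

theorem path_cen (hE : IsNodeIdem (v n) E) {j : ℕ} (hj : 2 ≤ j) (hjn : j ≤ n) :
    cen (v (j - 1)).H E ≤ cen (v (j - 1)).H (orbSum (v j).H E) ∧
      (v j).H ≤ cen (v (j - 1)).H (orbSum (v j).H E) ∧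
      cen (v (j - 1)).H (orbSum (v j).H E) ≤ normIn (v (j - 1)).H (kerIn (v j).θ) := by
  obtain ⟨f, hf, hfE, μ, hμ, hsum, -⟩ := exists_isNodeIdem hedge hE (by omega) hjn
  have he := hedge (j - 1) (by omega) (by omega)
  rw [Nat.sub_add_cancel (by omega)] at he
  have hpair := he.isCliffordPair hf
  rw [hsum, cen_smul hμ.ne']
  exact ⟨hpair.cen_le_cen hE.1.ne_zero hfE, hpair.le_cen, hpair.cen_le_normIn⟩

theorem path_normIn_le_cen {H : Subgroup G} {θ : H →* ℂˣ} (hvn : v n = ⟨H, H, θ⟩)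
    (hgood : IsGood θ n v) {j : ℕ} (hj : 2 ≤ j) (hjn : j ≤ n) :
    normIn (v (j - 1)).H (kerIn (v j).θ) ≤
      cen (v (j - 1)).H (orbSum (v j).H (eps H (kerIn θ))) := by
  have hchar := isCharIdem_eps θ
  have hE : IsNodeIdem (v n) (eps H (kerIn θ)) := by
    rw [hvn]
    exact ⟨hchar.isPrimCentral, hchar.idem⟩
  obtain ⟨f, hf, hfE, μ, hμ, hsum, -⟩ := exists_isNodeIdem hedge hE (by omega) hjn
  have he := hedge (j - 1) (by omega) (by omega)
  rw [Nat.sub_add_cancel (by omega)] at he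
  rw [hsum, cen_smul hμ.ne']
  have hHL := path_H_le hedge (by omega : 1 ≤ j) hjn
  rw [hvn] at hHL
  exact (he.isCliffordPair hf).normIn_le_cen hHL hchar hfE (hgood j (by omega) hjn)

end path

/-! ### From the leaf to the Shoda pair and its coefficient -/

theorem isShodaPair_of {H : Subgroup G} (θ : H →* ℂˣ)
    (h : ∀ g : G, (∀ h ∈ H, h⁻¹ * g⁻¹ * h * g ∈ H → h⁻¹ * g⁻¹ * h * g ∈ kerIn θ) → g ∈ H) :
    IsShodaPair H (kerIn θ) := by
  refine ⟨kerIn_le θ, ?_, h⟩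
  have hker : (kerIn θ).subgroupOf H = θ.ker := by
    ext x
    rw [Subgroup.mem_subgroupOf, mem_kerIn, ext_of_mem θ x.2, MonoidHom.mem_ker]
    simp
  rw [hker]
  have : Finite θ.range := inferInstanceAs (Finite (Set.range θ))
  exact ⟨inferInstance, isCyclic_of_injective (QuotientGroup.quotientKerEquivRange θ).toMonoidHom
    (QuotientGroup.quotientKerEquivRange θ).injective⟩

theorem alpha_eq {H K : Subgroup G} {r : ℚ}
    (h : IsPrimitiveCentralIdempotent (r • e ⊤ H K)) : alpha H K = r := by
  have hex : ∃ r : ℚ, IsPrimitiveCentralIdempotent (r • e ⊤ H K) := ⟨r, h⟩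
  rw [alpha, dif_pos hex]
  exact coeff_unique hex.choose_spec h

end

end CliffordTree

end

theorem theorem5p1 {G : Type*} [Group G] [Finite G] (hG : InClassC G)
    (N : Subgroup G) (hN : N.Normal) (c : Choice N)
    (H : Subgroup G) (θ : H →* ℂˣ) (n : ℕ) (v : ℕ → Triple G) (hleaf : IsLeaf c H θ n v)
    (K : Subgroup G) (hK : K = kerIn θ) :
    -- `α_(G, H, K)` is meaningful
    (IsShodaPair H K ∧ IsPrimitiveCentralIdempotent (alpha H K • e ⊤ H K)) ∧
    -- (i); for `n = 1` there is no `H_{n-1}`, and `α_(G, H, K) = 1` by (ii)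
    (2 ≤ n → alpha H K =
      ((cen (v (n - 1)).H (eps H K)).relIndex (cen ⊤ (eps H K)) : ℚ) /
        ∏ i ∈ Finset.Icc 2 (n - 1),
          ((v i).H.relIndex (cen (v (i - 1)).H (e (v i).H H K)) : ℚ)) ∧
    -- (ii)
    (alpha H K = 1 ↔ ∀ i, 2 ≤ i → i ≤ n - 1 →
      (cen (v (i - 1)).H (e (v i).H H K) : Set G) =
        (cen (v (i - 1)).H (eps H K) : Set G) * ((v i).H : Set G)) ∧
    -- (iii)
    (IsGood θ n v →
      (∀ i, 2 ≤ i → i ≤ n - 1 →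
        cen (v (i - 1)).H (e (v i).H H K) = normIn (v (i - 1)).H (kerIn (v i).θ)) ∧
      (2 ≤ n → alpha H K =
        ((cen (v (n - 1)).H (eps H K)).relIndex (cen ⊤ (eps H K)) : ℚ) /
          ∏ i ∈ Finset.Icc 2 (n - 1),
            ((v i).H.relIndex (normIn (v (i - 1)).H (kerIn (v i).θ)) : ℚ)) ∧
      (alpha H K = 1 ↔ ∀ i, 2 ≤ i → i ≤ n - 1 →
        (normIn (v (i - 1)).H (kerIn (v i).θ) : Set G) =
          (cen (v (i - 1)).H (eps H K) : Set G) * ((v i).H : Set G))) := by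
  subst hK
  obtain ⟨⟨hn, hroot, hedge, -⟩, hvn, -⟩ := hleaf
  have hchar := isCharIdem_eps θ
  set E := eps H (kerIn θ) with hEdef
  have hE : IsNodeIdem (v n) E := by
    rw [hvn]
    exact ⟨hchar.isPrimCentral, hchar.idem⟩
  have hv1 : (v 1).H = ⊤ := by rw [hroot]; rfl
  have hvnH : (v n).H = H := by rw [hvn]
  have hshoda : IsShodaPair H (kerIn θ) := by
    refine isShodaPair_of θ fun g hg => ?_
    have := path_mem_of_commutator hedge le_rfl hn (g := g) (by rw [hv1]; trivial)
    rw [hvn] at this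
    exact this hg
  have heE : ∀ X, e X H (kerIn θ) = orbSum X E := fun X => e_eq_orbSum X H _
  simp only [heE]
  obtain ⟨f, hf, -, μ, hμ, hsum, hμ1, hμ2⟩ := exists_isNodeIdem hedge hE le_rfl hn
  rw [hv1] at hsum hμ1
  -- the factor for the last node is trivial
  have hlast : orbSum (v n).H E = E :=
    orbSum_eq_self fun x hx => conj_eq_self_iff.2 (hE.1.comm x hx)
  have hcn : cen (v n).H E = (v n).H :=
    le_antisymm (fun x hx => hx.1) fun x hx => ⟨hx, hE.1.comm x hx⟩
  have hpci : IsPrimitiveCentralIdempotent (μ⁻¹ • e ⊤ H (kerIn θ)) := by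
    rw [heE, hsum, smul_smul, inv_mul_cancel₀ hμ.ne', one_smul]
    exact (hv1 ▸ hf.1 : IsPrimCentral ⊤ f).isPrimitiveCentralIdempotent
  have halpha := alpha_eq hpci
  have hIoc : 2 ≤ n → Finset.Ioc 1 n = insert n (Finset.Icc 2 (n - 1)) := fun h2 => by
    ext j; simp only [Finset.mem_insert, Finset.mem_Ioc, Finset.mem_Icc]; omega
  have hnot : n ∉ Finset.Icc 2 (n - 1) := by simp only [Finset.mem_Icc]; omega
  have formula : 2 ≤ n → alpha H (kerIn θ) =
      ((cen (v (n - 1)).H E).relIndex (cen ⊤ E) : ℚ) /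
        ∏ i ∈ Finset.Icc 2 (n - 1),
          ((v i).H.relIndex (cen (v (i - 1)).H (orbSum (v i).H E)) : ℚ) := by
    intro h2
    have hle : (v n).H ≤ cen (v (n - 1)).H E := by
      have := (path_cen hedge hE h2 le_rfl).2.1
      rwa [hlast] at this
    have hrel : ((v n).H.relIndex (cen (v (n - 1)).H E) : ℚ) * Nat.card (v n).H =
        Nat.card (cen (v (n - 1)).H E) := by
      exact_mod_cast relIndex_mul_card_of_le hle
    have hrel' : ((cen (v (n - 1)).H E).relIndex (cen ⊤ E) : ℚ) *
        Nat.card (cen (v (n - 1)).H E) = Nat.card (cen ⊤ E) := by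
      exact_mod_cast relIndex_mul_card_of_le
        (show cen (v (n - 1)).H E ≤ cen ⊤ E from fun x hx => ⟨trivial, hx.2⟩)
    -- At the leaf the orbit sum is `E` itself, so the factor for `i = n`, times `|H|`, is the order
    -- of the centralizer of `E` in `H_{n-1}`. That is why the product in (i) stops at `n - 1`.
    rw [hIoc h2, Finset.prod_insert hnot, hlast, hcn, ← mul_assoc,
      mul_comm (Nat.card (v n).H : ℚ), hrel, ← hrel'] at hμ1
    have h0 := card_subgroup_ne_zero (cen (v (n - 1)).H E)
    rw [halpha, eq_div_iff, inv_mul_eq_iff_eq_mul₀ hμ.ne']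
    · refine mul_right_cancel₀ h0 ?_
      rw [mul_comm, ← hμ1]
      ring
    · intro hP
      rw [hP, mul_zero, hrel'] at hμ1
      exact mul_ne_zero (card_subgroup_ne_zero _) hμ.ne' hμ1
  have hone : alpha H (kerIn θ) = 1 ↔ ∀ i, 2 ≤ i → i ≤ n - 1 →
      (cen (v (i - 1)).H (orbSum (v i).H E) : Set G) =
        (cen (v (i - 1)).H E : Set G) * ((v i).H : Set G) := by
    set q : ℕ → ℚ := fun j => (Nat.card (cen (v (j - 1)).H (orbSum (v j).H E)) : ℚ) /
      Nat.card ((cen (v (j - 1)).H E : Set G) * ((v j).H : Set G) : Set G)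
    have hpos : ∀ j, (0 : ℚ) <
        Nat.card ((cen (v (j - 1)).H E : Set G) * ((v j).H : Set G) : Set G) := fun j => by
      rw [card_mul_coe, Nat.cast_pos, ← Subgroup.inf_relIndex_left]
      refine Nat.pos_of_ne_zero (mul_ne_zero Nat.card_pos.ne' fun h0 => ?_)
      have := relIndex_mul_card_of_le
        (inf_le_left : cen (v (j - 1)).H E ⊓ (v j).H ≤ cen (v (j - 1)).H E)
      rw [h0, zero_mul] at this
      exact Nat.card_pos.ne this
    have hq1 : ∀ j, 2 ≤ j → j ≤ n → 1 ≤ q j := fun j hj hjn => by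
      obtain ⟨h1, h2, -⟩ := path_cen hedge hE hj hjn
      rw [one_le_div (hpos j), Nat.cast_le]
      exact card_mul_coe_le h1 h2
    have hq : ∀ j, 2 ≤ j → j ≤ n → (q j = 1 ↔
        (cen (v (j - 1)).H (orbSum (v j).H E) : Set G) =
          (cen (v (j - 1)).H E : Set G) * ((v j).H : Set G)) := fun j hj hjn => by
      obtain ⟨h1, h2, -⟩ := path_cen hedge hE hj hjn
      rw [div_eq_one_iff_eq (hpos j).ne', Nat.cast_inj, card_mul_coe_eq_iff h1 h2]
    have hprod : μ = ∏ j ∈ Finset.Icc 2 (n - 1), q j := by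
      rw [hμ2]
      rcases hn.eq_or_lt with h1 | h1
      -- For `n = 1` both index sets are empty, the upper bound `n - 1` being 0.
      · rw [← h1]; rfl
      · have hqn : q n = 1 := by
          obtain ⟨h2, h3, -⟩ := path_cen hedge hE h1 le_rfl
          rw [hq n h1 le_rfl, hlast]
          rw [hlast] at h3
          refine (mul_coe_subset le_rfl h3).antisymm' fun x hx => ?_
          exact ⟨x, hx, 1, one_mem _, mul_one x⟩
        rw [hIoc h1, Finset.prod_insert hnot]
        exact (congrArg (· * _) hqn).trans (one_mul _)
    rw [halpha, inv_eq_one, hprod]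
    constructor
    · intro h i hi hin
      rw [← hq i hi (by omega)]
      by_contra hne
      have hlt : 1 < q i := lt_of_le_of_ne (hq1 i hi (by omega)) (Ne.symm hne)
      -- All factors are at least 1, so a single factor above 1 would push the product above 1.
      have := Finset.prod_lt_prod (s := Finset.Icc 2 (n - 1)) (f := fun _ => (1 : ℚ)) (g := q)
        (fun _ _ => one_pos) (fun j hj => by
          rw [Finset.mem_Icc] at hj
          exact hq1 j hj.1 (by omega)) ⟨i, Finset.mem_Icc.2 ⟨hi, hin⟩, hlt⟩
      rw [Finset.prod_const_one, h] at this
      exact lt_irrefl _ this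
    · intro h
      refine Finset.prod_eq_one fun j hj => ?_
      rw [Finset.mem_Icc] at hj
      exact (hq j hj.1 (by omega)).2 (h j hj.1 hj.2)
  refine ⟨⟨hshoda, ?_⟩, formula, hone, fun hgood => ?_⟩
  · rw [halpha, ← heE]
    exact hpci
  · have hnorm : ∀ i, 2 ≤ i → i ≤ n - 1 → cen (v (i - 1)).H (orbSum (v i).H E) =
        normIn (v (i - 1)).H (kerIn (v i).θ) := fun i hi hin =>
      le_antisymm (path_cen hedge hE hi (by omega)).2.2
        (path_normIn_le_cen hedge hvn hgood hi (by omega))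
    refine ⟨hnorm, fun h2 => ?_, ?_⟩
    · rw [formula h2]
      congr 1
      refine Finset.prod_congr rfl fun i hi => ?_
      rw [Finset.mem_Icc] at hi
      rw [hnorm i hi.1 hi.2]
    · rw [hone]
      refine forall_congr' fun i => forall_congr' fun hi => forall_congr' fun hin => ?_
      rw [hnorm i hi hin]
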